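/- Let $\mathfrak g$ be the complex Kac-Moody Lie algebra of a generalized Cartan matrix (defined by a realization $(\mathfrak h,\Pi,\Pi^\vee)$, with the quotient by the largest ideal meeting $\mathfrak h$ trivially), let $\mathfrak g'=[\mathfrak g,\mathfrak g]$, $\mathfrak h'=\mathfrak h\cap\mathfrak g'$, let $N^+$ be the subalgebra generated by the Chevalley generators $e_i$, and fix a complement $\mathfrak h''$ of $\mathfrak h'$ in $\mathfrak h$. Let $n\ge 1$, $A=\mathbb C[t_1^{\pm1},\dots,t_n^{\pm1}]$, and write $V_A=V\otimes A$ and $x(m)=x\otimes t^m$ for $m\in\mathbb Z^n$. Let $D$ be the span of the degree derivations $d_1,\dots,d_n$, and put $$\tilde{\mathfrak g}_A=\mathfrak g'_A\oplus\mathfrak h''\oplus D,\qquad \tilde{\mathfrak h}_A=\mathfrak h'_A\oplus\mathfrak h''\oplus D,\qquad H=\mathfrak h'_A\oplus\mathfrak h'',$$ with $[x(r),y(s)]=[x,y](r+s)$, $[h,x(r)]=[h,x](r)$ for $h\in\mathfrak h''$, $[\mathfrak h'',\mathfrak h'']=0$, $[d_i,x(r)]=r_i\,x(r)$, $[h,d_i]=[d_i,d_j]=0$.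 Let $\bar\psi:U(H)\to A$ be a $\mathbb Z^n$-graded algebra homomorphism and $A_{\bar\psi}$ its image, an $\tilde{\mathfrak h}_A$-module on which $H$ acts by multiplication through $\bar\psi$ and $d_i t^s=s_it^s$. Let $\psi=E(1)\circ\bar\psi|_H\in H^*$, where $E(1)t^m=1$ for all $m$. For $\varphi\in H^*$ let $M(\varphi)$ be the $(\mathfrak g'_A\oplus\mathfrak h'')$-module induced from the one-dimensional $(N^+_A\oplus H)$-module on which $N^+_A$ acts by $0$ and $H$ by $\varphi$, and let $V(\varphi)$ be its unique irreducible quotient, the quotient by the sum of all proper submodules. Likewise, when $A_{\bar\psi}$ is irreducible, let $M(\bar\psi)$ be the $\tilde{\mathfrak g}_A$-module induced from the $(N^+_A\oplus\tilde{\mathfrak h}_A)$-module $A_{\bar\psi}$, on which $N^+_A$ acts by $0$, and let $V(\bar\psi)$ be its unique irreducible quotient, defined in the same way. A highest weight vector of a $(\mathfrak g'_A\oplus\mathfrak h'')$-module is a non-zero vector that generates the module, is killed by $N^+_A$, and on which $H$ acts through some element of $H^*$. Make $V(\psi)_A=V(\psi)\otimes A$ a $\tilde{\mathfrak g}_A$-module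 by $$x(m)\,v(r)=(x(m)v)(m+r),\qquad h\,v(r)=(hv)(r)\ \ (h\in\mathfrak h''),\qquad d_i\,v(r)=r_i\,v(r).$$ Assume that $A_{\bar\psi}$ is an irreducible $\tilde{\mathfrak h}_A$-module. Let $G\subset\mathbb Z^n$ be such that $\{t^m: m\in G\}$ is a set of coset representatives for $A/A_{\bar\psi}$, i.e. for every $k\in\mathbb Z^n$ there is exactly one $m\in G$ with $t^{k-m}\in A_{\bar\psi}$. Let $v$ be a highest weight vector of $V(\psi)$, and let $Uv(m)$ denote the $\tilde{\mathfrak g}_A$-submodule of $V(\psi)_A$ generated by $v(m)=v\otimes t^m$. Then: 1. $V(\psi)_A=\bigoplus_{m\in G}Uv(m)$ as $\tilde{\mathfrak g}_A$-modules. 2. For each $m\in G$, $Uv(m)$ is an irreducible $\tilde{\mathfrak g}_A$-module. 3. $Uv(0)\cong V(\bar\psi)$ as $\tilde{\mathfrak g}_A$-modules. 4. The assignment $\bar\psi\mapsto\psi=E(1)\circ\bar\psi|_H$ is a bijection from the $\mathbb Z^n$-graded algebra homomorphisms $U(H)\to A$ onto $H^*$. So the labels $\bar\psi$ of the graded modules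 $V(\bar\psi)$ (those with $A_{\bar\psi}$ irreducible) correspond one-to-one to the labels $\psi$ of the associated non-graded modules $V(\psi)$, with $V(\bar\psi)$ realized as in 3. -/

import Mathlib

open scoped TensorProduct

noncomputable section

namespace KacMoodyLoop

/-! ### Kac-Moody Lie algebras -/

/-- Generalized Cartan matrices. -/
structure IsGCM {l : ℕ} (C : Matrix (Fin l) (Fin l) ℤ) : Prop where
  diag : ∀ i, C i i = 2
  nonpos : ∀ i j, i ≠ j → C i j ≤ 0
  zero_symm : ∀ i j, C i j = 0 → C j i = 0

/-- A realization `(𝔥, Π, Π^∨)` of a square matrix `C` over the complex numbers. -/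
structure Realization {l : ℕ} (C : Matrix (Fin l) (Fin l) ℤ)
    (𝔥 : Type*) [AddCommGroup 𝔥] [Module ℂ 𝔥] where
  coroot : Fin l → 𝔥
  root : Fin l → Module.Dual ℂ 𝔥
  coroot_indep : LinearIndependent ℂ coroot
  root_indep : LinearIndependent ℂ root
  root_coroot : ∀ i j, root j (coroot i) = (C i j : ℂ)
  finrank_add_rank : Module.finrank ℂ 𝔥 + (C.map (fun a : ℤ => (a : ℂ))).rank = 2 * l

/-- Generators of a Kac-Moody algebra: the `e_i`, the `f_i` and the elements of `𝔥`. -/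
inductive Gen (l : ℕ) (𝔥 : Type*) where
  | e (i : Fin l) : Gen l 𝔥
  | f (i : Fin l) : Gen l 𝔥
  | h (x : 𝔥) : Gen l 𝔥

section KacMoody

variable {l : ℕ} {C : Matrix (Fin l) (Fin l) ℤ}
  {𝔥 : Type*} [AddCommGroup 𝔥] [Module ℂ 𝔥] (R : Realization C 𝔥)

/-- The generator `e_i` in the free Lie algebra. -/
abbrev fe {l : ℕ} (𝔥 : Type*) (i : Fin l) : FreeLieAlgebra ℂ (Gen l 𝔥) := FreeLieAlgebra.of ℂ (Gen.e i)

/-- The generator `f_i` in the free Lie algebra. -/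
abbrev ff {l : ℕ} (𝔥 : Type*) (i : Fin l) : FreeLieAlgebra ℂ (Gen l 𝔥) := FreeLieAlgebra.of ℂ (Gen.f i)

/-- The generator attached to `x ∈ 𝔥` in the free Lie algebra. -/
abbrev fh (l : ℕ) {𝔥 : Type*} (x : 𝔥) : FreeLieAlgebra ℂ (Gen l 𝔥) := FreeLieAlgebra.of ℂ (Gen.h x)

/-- The elements of the free Lie algebra that are set to zero in the auxiliary algebra. -/
inductive Realization.Rel : FreeLieAlgebra ℂ (Gen l 𝔥) → Prop
  | h_add (x y : 𝔥) : Rel (fh l (x + y) - fh l x - fh l y)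
  | h_smul (c : ℂ) (x : 𝔥) : Rel (fh l (c • x) - c • fh l x)
  | h_h (x y : 𝔥) : Rel ⁅fh l x, fh l y⁆
  | e_f (i : Fin l) : Rel (⁅fe 𝔥 i, ff 𝔥 i⁆ - fh l (R.coroot i))
  | e_f_ne (i j : Fin l) (hij : i ≠ j) : Rel ⁅fe 𝔥 i, ff 𝔥 j⁆
  | h_e (x : 𝔥) (i : Fin l) : Rel (⁅fh l x, fe 𝔥 i⁆ - R.root i x • fe 𝔥 i)
  | h_f (x : 𝔥) (i : Fin l) : Rel (⁅fh l x, ff 𝔥 i⁆ + R.root i x • ff 𝔥 i)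

/-- The ideal of relations of the auxiliary algebra. -/
def Realization.relIdeal : LieIdeal ℂ (FreeLieAlgebra ℂ (Gen l 𝔥)) :=
  LieSubmodule.lieSpan ℂ (FreeLieAlgebra ℂ (Gen l 𝔥)) {z | R.Rel z}

/-- The auxiliary Lie algebra with generators `e_i, f_i, 𝔥`, before the quotient by the largest
ideal meeting `𝔥` trivially. -/
def Realization.Aux : Type _ := FreeLieAlgebra ℂ (Gen l 𝔥) ⧸ R.relIdeal

instance : LieRing R.Aux := inferInstanceAs (LieRing (_ ⧸ R.relIdeal))
instance : LieAlgebra ℂ R.Aux := inferInstanceAs (LieAlgebra ℂ (_ ⧸ R.relIdeal))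

/-- The image of a generator in the auxiliary algebra. -/
def Realization.auxGen (g : Gen l 𝔥) : R.Aux :=
  LieSubmodule.Quotient.mk (N := R.relIdeal) (FreeLieAlgebra.of ℂ g)

/-- The largest ideal of the auxiliary algebra that meets (the image of) `𝔥` trivially. -/
def Realization.radIdeal : LieIdeal ℂ R.Aux :=
  sSup {I : LieIdeal ℂ R.Aux | ∀ x : 𝔥, R.auxGen (.h x) ∈ I → R.auxGen (.h x) = 0}

/-- The Kac-Moody Lie algebra of a realization. -/
def Realization.KM : Type _ := R.Aux ⧸ R.radIdeal

instance : LieRing R.KM := inferInstanceAs (LieRing (_ ⧸ R.radIdeal))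
instance : LieAlgebra ℂ R.KM := inferInstanceAs (LieAlgebra ℂ (_ ⧸ R.radIdeal))

/-- The image of a generator in the Kac-Moody algebra. -/
def Realization.gen (g : Gen l 𝔥) : R.KM :=
  LieSubmodule.Quotient.mk (N := R.radIdeal) (R.auxGen g)

theorem Realization.auxGen_rel {z : FreeLieAlgebra ℂ (Gen l 𝔥)} (hz : R.Rel z) :
    (LieSubmodule.Quotient.mk (N := R.relIdeal) z : R.Aux) = 0 :=
  (LieSubmodule.Quotient.mk_eq_zero' (N := R.relIdeal)).2 (LieSubmodule.subset_lieSpan hz)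

/-- The canonical linear map from `𝔥` to the Kac-Moody algebra. -/
def Realization.hMap : 𝔥 →ₗ[ℂ] R.KM where
  toFun x := R.gen (.h x)
  map_add' x y := by
    have h1 : R.auxGen (.h (x + y)) = R.auxGen (.h x) + R.auxGen (.h y) := by
      have := R.auxGen_rel (Realization.Rel.h_add x y)
      rw [← sub_eq_zero, ← sub_sub]
      exact this
    show LieSubmodule.Quotient.mk (N := R.radIdeal) (R.auxGen (.h (x + y))) = _
    rw [h1]; rfl
  map_smul' c x := by
    have h1 : R.auxGen (.h (c • x)) = c • R.auxGen (.h x) := by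
      have := R.auxGen_rel (Realization.Rel.h_smul c x)
      rw [← sub_eq_zero]
      exact this
    show LieSubmodule.Quotient.mk (N := R.radIdeal) (R.auxGen (.h (c • x))) = _
    rw [h1]; rfl

/-- The Cartan subalgebra `𝔥`, as a subspace of the Kac-Moody algebra. -/
def Realization.cartan : Submodule ℂ R.KM := LinearMap.range R.hMap

/-- The positive part: the subalgebra generated by the `e_i`. -/
def Realization.pos : LieSubalgebra ℂ R.KM :=
  LieSubalgebra.lieSpan ℂ R.KM (Set.range fun i => R.gen (.e i))

theorem Realization.cartan_abelian (x : R.KM) (hx : x ∈ R.cartan) (y : R.KM)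
    (hy : y ∈ R.cartan) : ⁅x, y⁆ = 0 := by
  obtain ⟨a, rfl⟩ := hx
  obtain ⟨b, rfl⟩ := hy
  have h1 : ⁅R.auxGen (.h a), R.auxGen (.h b)⁆ = 0 :=
    R.auxGen_rel (Realization.Rel.h_h a b)
  have h2 : ⁅R.gen (.h a), R.gen (.h b)⁆
      = LieSubmodule.Quotient.mk (N := R.radIdeal) ⁅R.auxGen (.h a), R.auxGen (.h b)⁆ := rfl
  show ⁅R.gen (.h a), R.gen (.h b)⁆ = 0
  rw [h2, h1]; rfl

end KacMoody

/-- The derived algebra `𝔤' = [𝔤, 𝔤]`, as a subspace. -/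
def derived (g : Type*) [LieRing g] [LieAlgebra ℂ g] : Submodule ℂ g :=
  (⁅(⊤ : LieIdeal ℂ g), (⊤ : LieIdeal ℂ g)⁆ : LieIdeal ℂ g).toSubmodule

/-- What the loop constructions use of `𝔤`: an abelian subalgebra `𝔥`, a complement `𝔥''` of
`𝔥' = 𝔥 ∩ 𝔤'` in `𝔥`, and a subalgebra `N⁺`. It is only applied to Kac-Moody algebras. -/
structure CartanSplit (g : Type*) [LieRing g] [LieAlgebra ℂ g] where
  cartan : Submodule ℂ g
  cartan_abelian : ∀ x ∈ cartan, ∀ y ∈ cartan, ⁅x, y⁆ = 0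
  compl : Submodule ℂ g
  compl_le : compl ≤ cartan
  disjoint : Disjoint (cartan ⊓ derived g) compl
  sup_eq : (cartan ⊓ derived g) ⊔ compl = cartan
  pos : LieSubalgebra ℂ g

/-- The data of a Kac-Moody algebra with its standard `𝔥` and `N⁺` and a chosen `𝔥''`. -/
def Realization.split {l : ℕ} {C : Matrix (Fin l) (Fin l) ℤ}
    {𝔥 : Type*} [AddCommGroup 𝔥] [Module ℂ 𝔥] (R : Realization C 𝔥)
    (h₂ : Submodule ℂ R.KM) (hle : h₂ ≤ R.cartan) (hdisj : Disjoint (R.cartan ⊓ derived R.KM) h₂)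
    (hsup : (R.cartan ⊓ derived R.KM) ⊔ h₂ = R.cartan) : CartanSplit R.KM where
  cartan := R.cartan
  cartan_abelian := R.cartan_abelian
  compl := h₂
  compl_le := hle
  disjoint := hdisj
  sup_eq := hsup
  pos := R.pos

/-! ### Laurent polynomials in `n` variables -/

/-- `A = ℂ[t₁^{±1}, …, t_n^{±1}]`. -/
abbrev LPoly (n : ℕ) : Type := AddMonoidAlgebra ℂ (Fin n → ℤ)

/-- The monomial `t^m`. -/
def T {n : ℕ} (m : Fin n → ℤ) : LPoly n := AddMonoidAlgebra.single m 1

/-- The span `D` of the degree derivations `d₁, …, d_n`, an abelian Lie algebra. -/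
def Deg (n : ℕ) : Type := Fin n → ℂ

instance (n : ℕ) : AddCommGroup (Deg n) := inferInstanceAs (AddCommGroup (Fin n → ℂ))
instance (n : ℕ) : Module ℂ (Deg n) := inferInstanceAs (Module ℂ (Fin n → ℂ))

instance (n : ℕ) : LieRing (Deg n) where
  bracket _ _ := 0
  add_lie _ _ _ := (add_zero 0).symm
  lie_add _ _ _ := (add_zero 0).symm
  lie_self _ := rfl
  leibniz_lie _ _ _ := (add_zero 0).symm

instance (n : ℕ) : LieAlgebra ℂ (Deg n) where
  lie_smul r _ _ := (smul_zero r).symm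

theorem Deg.lie_eq {n : ℕ} (c d : Deg n) : ⁅c, d⁆ = 0 := rfl

/-- The eigenvalue `∑ cᵢ mᵢ` of `∑ cᵢ dᵢ` in degree `m`. -/
def Deg.wt {n : ℕ} (c : Deg n) (m : Fin n → ℤ) : ℂ := ∑ i, (c i : ℂ) * (m i : ℂ)

theorem Deg.wt_add {n : ℕ} (c d : Deg n) (m : Fin n → ℤ) : (c + d).wt m = c.wt m + d.wt m := by
  simp only [Deg.wt, ← Finset.sum_add_distrib, ← add_mul]
  rfl

theorem Deg.wt_smul {n : ℕ} (r : ℂ) (c : Deg n) (m : Fin n → ℤ) : (r • c).wt m = r * c.wt m := by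
  simp only [Deg.wt, Finset.mul_sum, ← mul_assoc]
  rfl

theorem Deg.add_wt {n : ℕ} (c : Deg n) (m k : Fin n → ℤ) : c.wt (m + k) = c.wt m + c.wt k := by
  simp [Deg.wt, mul_add, Finset.sum_add_distrib]

/-- The derivation `∑ cᵢ tᵢ ∂/∂tᵢ` of `A`, that is, `t^m ↦ (∑ cᵢ mᵢ) t^m`. -/
def degMap {n : ℕ} (c : Deg n) : LPoly n →ₗ[ℂ] LPoly n :=
  (AddMonoidAlgebra.basis (Fin n → ℤ) ℂ).constr ℂ fun m => c.wt m • T m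

/-- Evaluation at `(1, …, 1)`, `E(1) : t^m ↦ 1`. -/
def evalOne (n : ℕ) : LPoly n →ₐ[ℂ] ℂ := AddMonoidAlgebra.lift ℂ ℂ (Fin n → ℤ) 1

theorem basis_apply {n : ℕ} (m : Fin n → ℤ) :
    AddMonoidAlgebra.basis (Fin n → ℤ) ℂ m = T m := by
  simp [T]

theorem degMap_T {n : ℕ} (c : Deg n) (m : Fin n → ℤ) :
    degMap c (T m) = c.wt m • T m := by
  rw [degMap, ← basis_apply m, Module.Basis.constr_basis, basis_apply]

theorem T_mul {n : ℕ} (m k : Fin n → ℤ) : T m * T k = T (m + k) := by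
  simp [T, AddMonoidAlgebra.single_mul_single]

theorem T_zero {n : ℕ} : (T 0 : LPoly n) = 1 := rfl

theorem LPoly.induct {n : ℕ} {P : LPoly n → Prop} (hT : ∀ m, P (T m)) (h0 : P 0)
    (hadd : ∀ a b, P a → P b → P (a + b)) (hsmul : ∀ (c : ℂ) a, P a → P (c • a)) (a : LPoly n) :
    P a := by
  have : a ∈ Submodule.span ℂ (Set.range (AddMonoidAlgebra.basis (Fin n → ℤ) ℂ)) := by
    rw [Module.Basis.span_eq]; trivial
  induction this using Submodule.span_induction with
  | mem x hx => obtain ⟨m, rfl⟩ := hx; rw [basis_apply]; exact hT m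
  | zero => exact h0
  | add x y _ _ hx hy => exact hadd _ _ hx hy
  | smul c x _ hx => exact hsmul _ _ hx

theorem degMap_mul {n : ℕ} (c : Deg n) (a b : LPoly n) :
    degMap c (a * b) = degMap c a * b + a * degMap c b := by
  induction a using LPoly.induct with
  | hT m =>
    induction b using LPoly.induct with
    | hT k =>
      simp only [T_mul, degMap_T, smul_mul_assoc, mul_smul_comm, ← add_smul]
      rw [Deg.add_wt]
    | h0 => simp
    | hadd x y hx hy => simp only [mul_add, map_add, hx, hy]; abel
    | hsmul r x hx => simp only [mul_smul_comm, map_smul, hx, smul_add]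
  | h0 => simp
  | hadd x y hx hy => simp only [add_mul, map_add, hx, hy]; abel
  | hsmul r x hx => simp only [smul_mul_assoc, map_smul, hx, smul_add]

theorem degMap_add {n : ℕ} (c d : Deg n) : degMap (c + d) = degMap c + degMap d := by
  refine LinearMap.ext fun a => ?_
  induction a using LPoly.induct with
  | hT m => simp [degMap_T, Deg.wt_add, add_smul]
  | h0 => simp
  | hadd x y hx hy => simp only [map_add, hx, hy]
  | hsmul r x hx => simp only [map_smul, hx]

theorem degMap_smul {n : ℕ} (r : ℂ) (c : Deg n) : degMap (r • c) = r • degMap c := by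
  refine LinearMap.ext fun a => ?_
  induction a using LPoly.induct with
  | hT m => simp [degMap_T, Deg.wt_smul, mul_smul]
  | h0 => simp
  | hadd x y hx hy => simp only [map_add, hx, hy]
  | hsmul t x hx => simp only [map_smul, hx]

theorem degMap_zero (n : ℕ) : degMap (0 : Deg n) = 0 := by
  have := degMap_smul (0 : ℂ) (0 : Deg n)
  rwa [zero_smul, zero_smul] at this

theorem degMap_comm {n : ℕ} (c d : Deg n) (a : LPoly n) :
    degMap c (degMap d a) = degMap d (degMap c a) := by
  induction a using LPoly.induct with
  | hT m => simp only [degMap_T, map_smul, smul_smul, mul_comm]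
  | h0 => simp
  | hadd x y hx hy => simp only [map_add, hx, hy]
  | hsmul t x hx => simp only [map_smul, hx]

/-! ### The loop algebras -/

section Loop

variable {g : Type*} [LieRing g] [LieAlgebra ℂ g]

/-- `W ⊗ A` for a subspace `W` of `𝔤`, inside `A ⊗ 𝔤`. -/
def loopSub (n : ℕ) (W : Submodule ℂ g) : Submodule ℂ (LPoly n ⊗[ℂ] g) :=
  Submodule.span ℂ {z | ∃ m, ∃ x ∈ W, z = T m ⊗ₜ[ℂ] x}

/-- `W ⊗ A + W₂ ⊗ 1` for subspaces `W, W₂` of `𝔤`, inside `A ⊗ 𝔤`. -/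
def affSub (n : ℕ) (W W₂ : Submodule ℂ g) : Submodule ℂ (LPoly n ⊗[ℂ] g) :=
  loopSub n W ⊔ W₂.map (TensorProduct.mk ℂ (LPoly n) g 1)

theorem mem_affSub {n : ℕ} {W W₂ : Submodule ℂ g} (m : Fin n → ℤ) {x : g} (hx : x ∈ W) :
    T m ⊗ₜ[ℂ] x ∈ affSub n W W₂ :=
  Submodule.mem_sup_left (Submodule.subset_span ⟨m, x, hx, rfl⟩)

theorem mem_affSub_zero {n : ℕ} {W W₂ : Submodule ℂ g} {x : g} (hx : x ∈ W₂) :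
    T 0 ⊗ₜ[ℂ] x ∈ affSub n W W₂ :=
  Submodule.mem_sup_right ⟨x, hx, rfl⟩

theorem affSub_le {n : ℕ} {W W₂ : Submodule ℂ g} {P : Submodule ℂ (LPoly n ⊗[ℂ] g)}
    (h1 : ∀ m, ∀ x ∈ W, T m ⊗ₜ[ℂ] x ∈ P) (h2 : ∀ x ∈ W₂, T 0 ⊗ₜ[ℂ] x ∈ P) :
    affSub n W W₂ ≤ P := by
  refine sup_le (Submodule.span_le.2 ?_) ?_
  · rintro _ ⟨m, x, hx, rfl⟩; exact h1 m x hx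
  · rintro _ ⟨x, hx, rfl⟩; exact h2 x hx

theorem loop_le {n : ℕ} {P : Submodule ℂ (LPoly n ⊗[ℂ] g)}
    (h : ∀ m x, T m ⊗ₜ[ℂ] x ∈ P) (z : LPoly n ⊗[ℂ] g) : z ∈ P := by
  induction z using TensorProduct.induction_on with
  | zero => exact P.zero_mem
  | tmul a x =>
    induction a using LPoly.induct with
    | hT m => exact h m x
    | h0 => rw [TensorProduct.zero_tmul]; exact P.zero_mem
    | hadd a b ha hb => rw [TensorProduct.add_tmul]; exact P.add_mem ha hb
    | hsmul c a ha => rw [← TensorProduct.smul_tmul']; exact P.smul_mem c ha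
  | add x y hx hy => exact P.add_mem hx hy

theorem lie_mem_loopSub {n : ℕ} (x y : LPoly n ⊗[ℂ] g) : ⁅x, y⁆ ∈ loopSub n (derived g) := by
  have key : ∀ z, z ∈ (loopSub n (derived g)).comap (LieAlgebra.ad ℂ (LPoly n ⊗[ℂ] g) x) := by
    refine loop_le fun k b => ?_
    have : ∀ w, w ∈ (loopSub n (derived g)).comap
        (LieAlgebra.ad ℂ (LPoly n ⊗[ℂ] g) (T k ⊗ₜ[ℂ] b)) := by
      refine loop_le fun m a => ?_
      refine Submodule.subset_span ⟨k + m, ⁅b, a⁆, ?_, ?_⟩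
      · exact LieSubmodule.lie_mem_lie (LieSubmodule.mem_top _) (LieSubmodule.mem_top _)
      · show ⁅T k ⊗ₜ[ℂ] b, T m ⊗ₜ[ℂ] a⁆ = _
        rw [LieAlgebra.ExtendScalars.bracket_tmul, T_mul]
    show ⁅x, T k ⊗ₜ[ℂ] b⁆ ∈ loopSub n (derived g)
    rw [← lie_skew]
    exact Submodule.neg_mem _ (this x)
  exact key y

theorem affSub_degMap {n : ℕ} {W W₂ : Submodule ℂ g} (c : Deg n) {x : LPoly n ⊗[ℂ] g}
    (hx : x ∈ affSub n W W₂) : (degMap c).rTensor g x ∈ affSub n W W₂ := by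
  have : affSub n W W₂ ≤ (affSub n W W₂).comap ((degMap c).rTensor g) := by
    refine affSub_le (fun m a ha => ?_) (fun a ha => ?_)
    · rw [Submodule.mem_comap, LinearMap.rTensor_tmul, degMap_T, ← TensorProduct.smul_tmul']
      exact Submodule.smul_mem _ _ (mem_affSub m ha)
    · rw [Submodule.mem_comap, LinearMap.rTensor_tmul, degMap_T, ← TensorProduct.smul_tmul']
      exact Submodule.smul_mem _ _ (mem_affSub_zero ha)
  exact this hx

theorem t_add_lie {n : ℕ} {L M : Type*} [LieRing L] [LieAlgebra ℂ L] [AddCommGroup M] [Module ℂ M]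
    [LieRingModule L M] [LieModule ℂ L M] (x y : LPoly n ⊗[ℂ] L) (w : LPoly n ⊗[ℂ] M) :
    ⁅x + y, w⁆ = ⁅x, w⁆ + ⁅y, w⁆ := add_lie x y w

theorem t_lie_add {n : ℕ} {L M : Type*} [LieRing L] [LieAlgebra ℂ L] [AddCommGroup M] [Module ℂ M]
    [LieRingModule L M] [LieModule ℂ L M] (x : LPoly n ⊗[ℂ] L) (v w : LPoly n ⊗[ℂ] M) :
    ⁅x, v + w⁆ = ⁅x, v⁆ + ⁅x, w⁆ := lie_add x v w

theorem t_zero_lie {n : ℕ} {L M : Type*} [LieRing L] [LieAlgebra ℂ L] [AddCommGroup M] [Module ℂ M]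
    [LieRingModule L M] [LieModule ℂ L M] (w : LPoly n ⊗[ℂ] M) :
    ⁅(0 : LPoly n ⊗[ℂ] L), w⁆ = 0 := zero_lie w

theorem t_lie_zero {n : ℕ} {L M : Type*} [LieRing L] [LieAlgebra ℂ L] [AddCommGroup M] [Module ℂ M]
    [LieRingModule L M] [LieModule ℂ L M] (x : LPoly n ⊗[ℂ] L) :
    ⁅x, (0 : LPoly n ⊗[ℂ] M)⁆ = 0 := lie_zero x

theorem t_lie_smul {n : ℕ} {L M : Type*} [LieRing L] [LieAlgebra ℂ L] [AddCommGroup M] [Module ℂ M]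
    [LieRingModule L M] [LieModule ℂ L M] (c : ℂ) (x : LPoly n ⊗[ℂ] L) (w : LPoly n ⊗[ℂ] M) :
    ⁅x, c • w⁆ = c • ⁅x, w⁆ := by
  rw [← algebraMap_smul (LPoly n) c w, ← algebraMap_smul (LPoly n) c ⁅x, w⁆]
  exact lie_smul (algebraMap ℂ (LPoly n) c) x w

theorem t_smul_lie {n : ℕ} {L M : Type*} [LieRing L] [LieAlgebra ℂ L] [AddCommGroup M] [Module ℂ M]
    [LieRingModule L M] [LieModule ℂ L M] (c : ℂ) (x : LPoly n ⊗[ℂ] L) (w : LPoly n ⊗[ℂ] M) :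
    ⁅c • x, w⁆ = c • ⁅x, w⁆ := by
  rw [← algebraMap_smul (LPoly n) c x, ← algebraMap_smul (LPoly n) c ⁅x, w⁆]
  exact smul_lie (algebraMap ℂ (LPoly n) c) x w

theorem t_sub_lie {n : ℕ} {L M : Type*} [LieRing L] [LieAlgebra ℂ L] [AddCommGroup M] [Module ℂ M]
    [LieRingModule L M] [LieModule ℂ L M] (x y : LPoly n ⊗[ℂ] L) (w : LPoly n ⊗[ℂ] M) :
    ⁅x - y, w⁆ = ⁅x, w⁆ - ⁅y, w⁆ := sub_lie x y w

theorem t_leibniz {n : ℕ} {L M : Type*} [LieRing L] [LieAlgebra ℂ L] [AddCommGroup M] [Module ℂ M]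
    [LieRingModule L M] [LieModule ℂ L M] (x y : LPoly n ⊗[ℂ] L) (w : LPoly n ⊗[ℂ] M) :
    ⁅x, ⁅y, w⁆⁆ = ⁅⁅x, y⁆, w⁆ + ⁅y, ⁅x, w⁆⁆ :=
  LieRingModule.leibniz_lie x y w

/-- The degree derivations act on `A ⊗ M` through the first factor, compatibly with the action of
`A ⊗ L`. -/
theorem degMap_lie {n : ℕ} {L M : Type*} [LieRing L] [LieAlgebra ℂ L] [AddCommGroup M] [Module ℂ M]
    [LieRingModule L M] [LieModule ℂ L M] (c : Deg n) (x : LPoly n ⊗[ℂ] L) (w : LPoly n ⊗[ℂ] M) :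
    (degMap c).rTensor M ⁅x, w⁆ = ⁅(degMap c).rTensor L x, w⁆ + ⁅x, (degMap c).rTensor M w⁆ := by
  induction x using TensorProduct.induction_on with
  | zero => simp only [t_zero_lie, map_zero, add_zero]
  | add x y hx hy => simp only [t_add_lie, map_add, hx, hy]; abel
  | tmul a x =>
    induction w using TensorProduct.induction_on with
    | zero => simp only [t_lie_zero, map_zero, add_zero]
    | add v w hv hw => simp only [t_lie_add, map_add, hv, hw]; abel
    | tmul b v =>
      simp only [LieAlgebra.ExtendScalars.bracket_tmul, LinearMap.rTensor_tmul, degMap_mul,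
        TensorProduct.add_tmul]

namespace CartanSplit

variable (S : CartanSplit g) (n : ℕ)

/-- `𝔤'_A ⊕ 𝔥''`, as a subalgebra of `A ⊗ 𝔤`. -/
def loopAlg : LieSubalgebra ℂ (LPoly n ⊗[ℂ] g) where
  __ := affSub n (derived g) S.compl
  lie_mem' {x y} _ _ := Submodule.mem_sup_left (lie_mem_loopSub x y)

variable {S n} in
theorem lie_eq_zero {x y : LPoly n ⊗[ℂ] g} (hx : x ∈ affSub n (S.cartan ⊓ derived g) S.compl)
    (hy : y ∈ affSub n (S.cartan ⊓ derived g) S.compl) : ⁅x, y⁆ = 0 := by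
  have hle : affSub n (S.cartan ⊓ derived g) S.compl ≤ loopSub n S.cartan := by
    refine affSub_le (fun m a ha => ?_) (fun a ha => ?_)
    · exact Submodule.subset_span ⟨m, a, ha.1, rfl⟩
    · exact Submodule.subset_span ⟨0, a, S.compl_le ha, rfl⟩
  refine Submodule.span_induction₂ (R := ℂ) (p := fun x y _ _ => ⁅x, y⁆ = 0)
    ?_ ?_ ?_ ?_ ?_ ?_ ?_ (hle hx) (hle hy)
  · rintro _ _ ⟨m, a, ha, rfl⟩ ⟨k, b, hb, rfl⟩
    rw [LieAlgebra.ExtendScalars.bracket_tmul, S.cartan_abelian a ha b hb, TensorProduct.tmul_zero]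
  · intro y _; exact t_zero_lie y
  · intro y _; exact t_lie_zero y
  · intro x y z _ _ _ h1 h2; rw [t_add_lie, h1, h2, add_zero]
  · intro x y z _ _ _ h1 h2; rw [t_lie_add, h1, h2, add_zero]
  · intro r x y _ _ h
    have : ⁅r • x, y⁆ = r • ⁅x, y⁆ := smul_lie r x y
    rw [this, h, smul_zero]
  · intro r x y _ _ h
    have : ⁅x, r • y⁆ = r • ⁅x, y⁆ := lie_smul r x y
    rw [this, h, smul_zero]

/-- `H = 𝔥' ⊗ A ⊕ 𝔥''`, as a subalgebra of `𝔤'_A ⊕ 𝔥''`. -/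
def loopCartan : LieSubalgebra ℂ (S.loopAlg n) where
  __ := (affSub n (S.cartan ⊓ derived g) S.compl).comap (S.loopAlg n).toSubmodule.subtype
  lie_mem' {x y} hx hy := by
    show ⁅(x : LPoly n ⊗[ℂ] g), (y : LPoly n ⊗[ℂ] g)⁆ ∈
      affSub n (S.cartan ⊓ derived g) S.compl
    have h : ⁅(x : LPoly n ⊗[ℂ] g), (y : LPoly n ⊗[ℂ] g)⁆ = 0 := lie_eq_zero hx hy
    rw [h]
    exact Submodule.zero_mem _

/-- `N⁺_A = N⁺ ⊗ A`, as a subspace of `𝔤'_A ⊕ 𝔥''`. -/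
def loopPos : Submodule ℂ (S.loopAlg n) :=
  (loopSub n S.pos.toSubmodule).comap (S.loopAlg n).toSubmodule.subtype

/-- The derivation `X(m) ↦ (∑ cᵢ mᵢ) X(m)` of `𝔤'_A ⊕ 𝔥''`. -/
def degDerAux (c : Deg n) : LieDerivation ℂ (S.loopAlg n) (S.loopAlg n) where
  toLinearMap := ((degMap c).rTensor g).restrict (p := (S.loopAlg n).toSubmodule)
    (q := (S.loopAlg n).toSubmodule) fun _ hx => affSub_degMap c hx
  leibniz' a b := by
    apply Subtype.ext
    show (degMap c).rTensor g ⁅(a : LPoly n ⊗[ℂ] g), (b : LPoly n ⊗[ℂ] g)⁆ =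
      ⁅(a : LPoly n ⊗[ℂ] g), (degMap c).rTensor g (b : LPoly n ⊗[ℂ] g)⁆ -
      ⁅(b : LPoly n ⊗[ℂ] g), (degMap c).rTensor g (a : LPoly n ⊗[ℂ] g)⁆
    rw [degMap_lie, ← lie_skew (b : LPoly n ⊗[ℂ] g)]
    abel

theorem coe_degDerAux (c : Deg n) (x : S.loopAlg n) :
    (S.degDerAux n c x : LPoly n ⊗[ℂ] g) = (degMap c).rTensor g x := rfl

theorem degDerAux_comm (c d : Deg n) (x : S.loopAlg n) :
    S.degDerAux n c (S.degDerAux n d x) = S.degDerAux n d (S.degDerAux n c x) := by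
  apply Subtype.ext
  rw [coe_degDerAux, coe_degDerAux, coe_degDerAux, coe_degDerAux,
    ← LinearMap.rTensor_comp_apply, ← LinearMap.rTensor_comp_apply,
    show degMap c ∘ₗ degMap d = degMap d ∘ₗ degMap c from LinearMap.ext (degMap_comm c d)]

/-- The action of `D` on `𝔤'_A ⊕ 𝔥''` by degree derivations. -/
def degDer : Deg n →ₗ⁅ℂ⁆ LieDerivation ℂ (S.loopAlg n) (S.loopAlg n) where
  toFun := S.degDerAux n
  map_add' c d := by
    refine LieDerivation.ext fun x => Subtype.ext ?_
    rw [coe_degDerAux, degMap_add, LinearMap.rTensor_add]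
    rfl
  map_smul' r c := by
    refine LieDerivation.ext fun x => Subtype.ext ?_
    rw [coe_degDerAux, degMap_smul, LinearMap.rTensor_smul]
    rfl
  map_lie' {c d} := by
    refine LieDerivation.ext fun x => ?_
    rw [LieDerivation.commutator_apply]
    have h : S.degDerAux n ⁅c, d⁆ x = 0 := by
      apply Subtype.ext
      rw [coe_degDerAux, Deg.lie_eq, degMap_zero, LinearMap.rTensor_zero]
      rfl
    exact h.trans (sub_eq_zero.2 (S.degDerAux_comm n c d x)).symm

/-- The graded loop Kac-Moody algebra `𝔤̃_A = 𝔤'_A ⊕ 𝔥'' ⊕ D`. -/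
abbrev tAlg : Type _ := S.loopAlg n ⋊⁅S.degDer n⁆ Deg n

/-- `𝔥̃_A = 𝔥' ⊗ A ⊕ 𝔥'' ⊕ D`. -/
def tCartan : LieSubalgebra ℂ (S.tAlg n) where
  carrier := {z | z.left ∈ S.loopCartan n}
  add_mem' := fun ha hb => (S.loopCartan n).add_mem ha hb
  zero_mem' := (S.loopCartan n).zero_mem
  smul_mem' := fun c _ hx => (S.loopCartan n).smul_mem c hx
  lie_mem' {x y} hx hy := by
    refine (S.loopCartan n).sub_mem ((S.loopCartan n).add_mem ?_ ?_) ?_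
    · exact (S.loopCartan n).lie_mem hx hy
    · exact affSub_degMap x.right hy
    · exact affSub_degMap y.right hx

/-! ### Homogeneous components -/

variable {S n} in
theorem loopAlg_le {P : Submodule ℂ (S.loopAlg n)}
    (h : ∀ m (y : S.loopAlg n) (a : g), (y : LPoly n ⊗[ℂ] g) = T m ⊗ₜ[ℂ] a → y ∈ P)
    (x : S.loopAlg n) : x ∈ P := by
  have hle : affSub n (derived g) S.compl ≤ P.map (S.loopAlg n).toSubmodule.subtype := by
    refine affSub_le (fun m a ha => ?_) (fun a ha => ?_)
    · exact ⟨⟨T m ⊗ₜ[ℂ] a, mem_affSub m ha⟩, h m _ a rfl, rfl⟩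
    · exact ⟨⟨T 0 ⊗ₜ[ℂ] a, mem_affSub_zero ha⟩, h 0 _ a rfl, rfl⟩
  obtain ⟨y, hy, hyx⟩ := hle x.2
  have : y = x := Subtype.ext hyx
  exact this ▸ hy

variable {S n} in
theorem loopCartan_le {P : Submodule ℂ (S.loopCartan n)}
    (h : ∀ m (y : S.loopCartan n) (a : g),
      ((y : S.loopAlg n) : LPoly n ⊗[ℂ] g) = T m ⊗ₜ[ℂ] a → y ∈ P)
    (x : S.loopCartan n) : x ∈ P := by
  have hle : affSub n (S.cartan ⊓ derived g) S.compl ≤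
      (P.map (S.loopCartan n).toSubmodule.subtype).map (S.loopAlg n).toSubmodule.subtype := by
    refine affSub_le (fun m a ha => ?_) (fun a ha => ?_)
    · exact ⟨⟨T m ⊗ₜ[ℂ] a, mem_affSub m ha.2⟩,
        ⟨⟨⟨T m ⊗ₜ[ℂ] a, mem_affSub m ha.2⟩, mem_affSub m ha⟩, h m _ a rfl, rfl⟩, rfl⟩
    · exact ⟨⟨T 0 ⊗ₜ[ℂ] a, mem_affSub_zero ha⟩,
        ⟨⟨⟨T 0 ⊗ₜ[ℂ] a, mem_affSub_zero ha⟩, mem_affSub_zero ha⟩, h 0 _ a rfl, rfl⟩, rfl⟩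
  obtain ⟨_, ⟨y, hy, rfl⟩, hyx⟩ := hle x.2
  have : y = x := Subtype.ext (Subtype.ext hyx)
  exact this ▸ hy

end CartanSplit

/-- The coefficient of `t^m` of an element of `A ⊗ 𝔤`. -/
def coeffAt {n : ℕ} (m : Fin n → ℤ) : LPoly n ⊗[ℂ] g →ₗ[ℂ] g :=
  Finsupp.lapply m ∘ₗ (LieAlgebra.LoopAlgebra.toFinsupp ℂ (Fin n → ℤ) g).toLinearMap

theorem coeffAt_T {n : ℕ} (m k : Fin n → ℤ) (a : g) :
    coeffAt m (T k ⊗ₜ[ℂ] a) = if k = m then a else 0 := by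
  show LieAlgebra.LoopAlgebra.toFinsupp ℂ (Fin n → ℤ) g (AddMonoidAlgebra.single k 1 ⊗ₜ[ℂ] a) m = _
  rw [LieAlgebra.LoopAlgebra.toFinsupp_single_tmul, Finsupp.single_apply]

theorem coeffAt_mem {n : ℕ} {W W₂ : Submodule ℂ g} (m : Fin n → ℤ) {x : LPoly n ⊗[ℂ] g}
    (hx : x ∈ affSub n W W₂) : T m ⊗ₜ[ℂ] coeffAt m x ∈ affSub n W W₂ := by
  have : affSub n W W₂ ≤ (affSub n W W₂).comap
      (TensorProduct.mk ℂ (LPoly n) g (T m) ∘ₗ coeffAt m) := by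
    refine affSub_le (fun k a ha => ?_) (fun a ha => ?_)
    · show T m ⊗ₜ[ℂ] coeffAt m (T k ⊗ₜ[ℂ] a) ∈ affSub n W W₂
      rw [coeffAt_T]
      split_ifs with h
      · exact mem_affSub m ha
      · rw [TensorProduct.tmul_zero]; exact Submodule.zero_mem _
    · show T m ⊗ₜ[ℂ] coeffAt m (T 0 ⊗ₜ[ℂ] a) ∈ affSub n W W₂
      rw [coeffAt_T]
      split_ifs with h
      · exact h ▸ mem_affSub_zero ha
      · rw [TensorProduct.tmul_zero]; exact Submodule.zero_mem _
  exact this hx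

namespace CartanSplit

variable (S : CartanSplit g) (n : ℕ)

/-- The homogeneous component of degree `m`, as a map of `𝔤'_A ⊕ 𝔥''` to itself. -/
def comp (m : Fin n → ℤ) : S.loopAlg n →ₗ[ℂ] S.loopAlg n :=
  (TensorProduct.mk ℂ (LPoly n) g (T m) ∘ₗ coeffAt m).restrict
    (p := (S.loopAlg n).toSubmodule) (q := (S.loopAlg n).toSubmodule)
    fun _ hx => coeffAt_mem m hx

theorem coe_comp (m : Fin n → ℤ) (x : S.loopAlg n) :
    (S.comp n m x : LPoly n ⊗[ℂ] g) = T m ⊗ₜ[ℂ] coeffAt m (x : LPoly n ⊗[ℂ] g) := rfl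

/-- The degrees in which an element has a non-zero component. -/
def degs {n : ℕ} (x : LPoly n ⊗[ℂ] g) : Finset (Fin n → ℤ) :=
  (LieAlgebra.LoopAlgebra.toFinsupp ℂ (Fin n → ℤ) g x).support

theorem comp_eq_zero {m : Fin n → ℤ} {x : S.loopAlg n} (h : m ∉ degs (x : LPoly n ⊗[ℂ] g)) :
    S.comp n m x = 0 := by
  apply Subtype.ext
  have h0 : coeffAt m (x : LPoly n ⊗[ℂ] g) = 0 := Finsupp.notMem_support_iff.1 h
  rw [coe_comp, h0, TensorProduct.tmul_zero]
  rfl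

/-- The map `x = ∑ x_m ↦ ∑ t^m ⊗ x_m`, with `x_m` the component of degree `m` of `x`. -/
def coactFun (x : S.loopAlg n) : LPoly n ⊗[ℂ] S.loopAlg n :=
  ∑ m ∈ degs (x : LPoly n ⊗[ℂ] g), T m ⊗ₜ[ℂ] S.comp n m x

theorem coactFun_eq {x : S.loopAlg n} {s : Finset (Fin n → ℤ)}
    (hs : degs (x : LPoly n ⊗[ℂ] g) ⊆ s) : S.coactFun n x = ∑ m ∈ s, T m ⊗ₜ[ℂ] S.comp n m x :=
  Finset.sum_subset hs fun m _ h => by rw [S.comp_eq_zero n h, TensorProduct.tmul_zero]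

/-- `coactFun` as a linear map. -/
def coactLin : S.loopAlg n →ₗ[ℂ] LPoly n ⊗[ℂ] S.loopAlg n where
  toFun := S.coactFun n
  map_add' x y := by
    classical
    set s := degs (x : LPoly n ⊗[ℂ] g) ∪ degs (y : LPoly n ⊗[ℂ] g) ∪
      degs ((x + y : S.loopAlg n) : LPoly n ⊗[ℂ] g) with hs
    rw [S.coactFun_eq n (s := s) (x := x) (by rw [hs]; grind),
      S.coactFun_eq n (s := s) (x := y) (by rw [hs]; grind),
      S.coactFun_eq n (s := s) (x := x + y) (by rw [hs]; grind), ← Finset.sum_add_distrib]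
    exact Finset.sum_congr rfl fun m _ => by rw [map_add, TensorProduct.tmul_add]
  map_smul' c x := by
    classical
    set s := degs (x : LPoly n ⊗[ℂ] g) ∪ degs ((c • x : S.loopAlg n) : LPoly n ⊗[ℂ] g) with hs
    rw [S.coactFun_eq n (s := s) (x := x) (by rw [hs]; grind),
      S.coactFun_eq n (s := s) (x := c • x) (by rw [hs]; grind), RingHom.id_apply, Finset.smul_sum]
    exact Finset.sum_congr rfl fun m _ => by rw [map_smul, TensorProduct.tmul_smul]

theorem coactLin_homog {m : Fin n → ℤ} {y : S.loopAlg n} {a : g}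
    (h : (y : LPoly n ⊗[ℂ] g) = T m ⊗ₜ[ℂ] a) : S.coactLin n y = T m ⊗ₜ[ℂ] y := by
  have hs : degs (y : LPoly n ⊗[ℂ] g) ⊆ {m} := by
    intro k hk
    rw [Finset.mem_singleton]
    by_contra hne
    have h1 : coeffAt k (y : LPoly n ⊗[ℂ] g) ≠ 0 := Finsupp.mem_support_iff.1 hk
    rw [h, coeffAt_T, if_neg (Ne.symm hne)] at h1
    exact h1 rfl
  have hc : S.comp n m y = y := by
    apply Subtype.ext
    rw [coe_comp, h, coeffAt_T, if_pos rfl]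
  show S.coactFun n y = _
  rw [S.coactFun_eq n hs, Finset.sum_singleton, hc]

theorem coactLin_lie (x y : S.loopAlg n) :
    S.coactLin n ⁅x, y⁆ = ⁅S.coactLin n x, S.coactLin n y⁆ := by
  have h1 : ∀ m (x : S.loopAlg n) (a : g), (x : LPoly n ⊗[ℂ] g) = T m ⊗ₜ[ℂ] a →
      ∀ y, S.coactLin n ⁅x, y⁆ = ⁅S.coactLin n x, S.coactLin n y⁆ := by
    intro m x a hx y
    have := loopAlg_le (S := S) (n := n) (P := LinearMap.eqLocus
      (S.coactLin n ∘ₗ (LieAlgebra.ad ℂ (S.loopAlg n) x))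
      ((LieAlgebra.ad ℂ (LPoly n ⊗[ℂ] S.loopAlg n) (S.coactLin n x)) ∘ₗ S.coactLin n))
      (fun k y b hy => ?_) y
    · exact this
    · show S.coactLin n ⁅x, y⁆ = ⁅S.coactLin n x, S.coactLin n y⁆
      have hxy : ((⁅x, y⁆ : S.loopAlg n) : LPoly n ⊗[ℂ] g) = T (m + k) ⊗ₜ[ℂ] ⁅a, b⁆ := by
        rw [LieSubalgebra.coe_bracket, hx, hy, LieAlgebra.ExtendScalars.bracket_tmul, T_mul]
      rw [S.coactLin_homog n hx, S.coactLin_homog n hy, S.coactLin_homog n hxy,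
        LieAlgebra.ExtendScalars.bracket_tmul, T_mul]
  have := loopAlg_le (S := S) (n := n) (P := LinearMap.eqLocus
      (S.coactLin n ∘ₗ (LieAlgebra.ad ℂ (S.loopAlg n) y))
      ((LieAlgebra.ad ℂ (LPoly n ⊗[ℂ] S.loopAlg n) (S.coactLin n y)) ∘ₗ S.coactLin n))
      (fun k x b hx => ?_) x
  · have h2 : S.coactLin n ⁅y, x⁆ = ⁅S.coactLin n y, S.coactLin n x⁆ := this
    rw [← lie_skew, map_neg, h2]
    exact lie_skew _ _
  · show S.coactLin n ⁅y, x⁆ = ⁅S.coactLin n y, S.coactLin n x⁆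
    rw [← lie_skew, map_neg, h1 k x b hx y]
    exact lie_skew _ _

/-- The Lie algebra homomorphism `𝔤'_A ⊕ 𝔥'' → A ⊗ (𝔤'_A ⊕ 𝔥'')`, `X(m) ↦ t^m ⊗ X(m)`. -/
def coact : S.loopAlg n →ₗ⁅ℂ⁆ LPoly n ⊗[ℂ] S.loopAlg n where
  __ := S.coactLin n
  map_lie' {x y} := S.coactLin_lie n x y

theorem coact_degDer (c : Deg n) (x : S.loopAlg n) :
    S.coact n (S.degDer n c x) = (degMap c).rTensor (S.loopAlg n) (S.coact n x) := by
  have := loopAlg_le (S := S) (n := n) (P := LinearMap.eqLocus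
    (S.coactLin n ∘ₗ (S.degDer n c).toLinearMap)
    ((degMap c).rTensor (S.loopAlg n) ∘ₗ S.coactLin n)) (fun m y a hy => ?_) x
  · exact this
  · have hd : S.degDer n c y = c.wt m • y := by
      apply Subtype.ext
      show (degMap c).rTensor g (y : LPoly n ⊗[ℂ] g) = c.wt m • (y : LPoly n ⊗[ℂ] g)
      rw [hy, LinearMap.rTensor_tmul, degMap_T, TensorProduct.smul_tmul']
    show S.coactLin n (S.degDer n c y) = (degMap c).rTensor (S.loopAlg n) (S.coactLin n y)
    rw [hd, map_smul, S.coactLin_homog n hy, LinearMap.rTensor_tmul, degMap_T,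
      TensorProduct.smul_tmul']

end CartanSplit

end Loop

/-! ### The graded module `V ⊗ A` attached to a module `V` -/

section LoopModule

variable {g : Type*} [LieRing g] [LieAlgebra ℂ g] (S : CartanSplit g) (n : ℕ)
  (V : Type*) [AddCommGroup V] [Module ℂ V] [LieRingModule (S.loopAlg n) V]
  [LieModule ℂ (S.loopAlg n) V]

/-- `V_A = V ⊗ A`, for a module `V` over `𝔤'_A ⊕ 𝔥''`. -/
def CartanSplit.LoopModule : Type _ :=
  let _ := S
  LPoly n ⊗[ℂ] V

instance : AddCommGroup (S.LoopModule n V) := inferInstanceAs (AddCommGroup (LPoly n ⊗[ℂ] V))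
instance : Module ℂ (S.LoopModule n V) := inferInstanceAs (Module ℂ (LPoly n ⊗[ℂ] V))

variable {V} in
/-- The vector `v(m) = v ⊗ t^m` of `V_A`. -/
def CartanSplit.vec (m : Fin n → ℤ) (v : V) : S.LoopModule n V := (T m ⊗ₜ[ℂ] v : LPoly n ⊗[ℂ] V)

/-- The action of `𝔤̃_A` on `V_A`. -/
def CartanSplit.loopAct (z : S.tAlg n) : (LPoly n ⊗[ℂ] V) →ₗ[ℂ] (LPoly n ⊗[ℂ] V) where
  toFun w := ⁅S.coact n z.left, w⁆ + (degMap z.right).rTensor V w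
  map_add' v w := by rw [t_lie_add, map_add]; abel
  map_smul' c w := by rw [t_lie_smul, map_smul, smul_add, RingHom.id_apply]

theorem CartanSplit.loopAct_apply (z : S.tAlg n) (w : LPoly n ⊗[ℂ] V) :
    S.loopAct n V z w = ⁅S.coact n z.left, w⁆ + (degMap z.right).rTensor V w := rfl

theorem CartanSplit.loopAct_add (x y : S.tAlg n) (w : LPoly n ⊗[ℂ] V) :
    S.loopAct n V (x + y) w = S.loopAct n V x w + S.loopAct n V y w := by
  rw [S.loopAct_apply, S.loopAct_apply, S.loopAct_apply, LieAlgebra.SemiDirectSum.add_eq_mk,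
    map_add, t_add_lie, degMap_add, LinearMap.rTensor_add, LinearMap.add_apply]
  abel

theorem CartanSplit.loopAct_smul (c : ℂ) (x : S.tAlg n) (w : LPoly n ⊗[ℂ] V) :
    S.loopAct n V (c • x) w = c • S.loopAct n V x w := by
  rw [S.loopAct_apply, S.loopAct_apply, LieAlgebra.SemiDirectSum.smul_eq_mk,
    map_smul, t_smul_lie, degMap_smul, LinearMap.rTensor_smul, LinearMap.smul_apply, smul_add]

theorem CartanSplit.loopAct_lie (x y : S.tAlg n) (w : LPoly n ⊗[ℂ] V) :
    S.loopAct n V x (S.loopAct n V y w) =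
      S.loopAct n V ⁅x, y⁆ w + S.loopAct n V y (S.loopAct n V x w) := by
  have h1 : S.coact n (⁅x, y⁆ : S.tAlg n).left = ⁅S.coact n x.left, S.coact n y.left⁆
      + (degMap x.right).rTensor (S.loopAlg n) (S.coact n y.left)
      - (degMap y.right).rTensor (S.loopAlg n) (S.coact n x.left) := by
    rw [← S.coact_degDer, ← S.coact_degDer, ← LieHom.map_lie, ← map_add, ← map_sub]
    rfl
  have h2 : (⁅x, y⁆ : S.tAlg n).right = 0 := rfl
  have h3 : (degMap x.right).rTensor V ((degMap y.right).rTensor V w) =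
      (degMap y.right).rTensor V ((degMap x.right).rTensor V w) := by
    rw [← LinearMap.rTensor_comp_apply, ← LinearMap.rTensor_comp_apply,
      show degMap x.right ∘ₗ degMap y.right = degMap y.right ∘ₗ degMap x.right from
        LinearMap.ext (degMap_comm x.right y.right)]
  simp only [S.loopAct_apply]
  rw [h1, h2, degMap_zero, LinearMap.rTensor_zero, LinearMap.zero_apply, t_sub_lie, t_add_lie,
    t_lie_add, t_lie_add, map_add, map_add, degMap_lie, degMap_lie, h3, t_leibniz]
  abel

/-- `X(m) v(r) = (X(m) v)(m + r)` for `X(m) ∈ 𝔤'_A ⊕ 𝔥''`, and `dᵢ v(r) = rᵢ v(r)`. -/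
instance : LieRingModule (S.tAlg n) (S.LoopModule n V) where
  bracket z w := S.loopAct n V z w
  add_lie x y w := S.loopAct_add n V x y w
  lie_add x v w := map_add (S.loopAct n V x) v w
  leibniz_lie x y w := S.loopAct_lie n V x y w

instance : LieModule ℂ (S.tAlg n) (S.LoopModule n V) where
  smul_lie c x w := S.loopAct_smul n V c x w
  lie_smul c x w := map_smul (S.loopAct n V x) c w

/-- The action of a homogeneous element on `v(r)`. -/
theorem CartanSplit.lie_vec (m r : Fin n → ℤ) (x : S.loopAlg n) (a : g)
    (hx : (x : LPoly n ⊗[ℂ] g) = T m ⊗ₜ[ℂ] a) (v : V) :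
    ⁅(⟨x, 0⟩ : S.tAlg n), S.vec n r v⁆ = S.vec n (m + r) ⁅x, v⁆ := by
  show S.loopAct n V ⟨x, 0⟩ (T r ⊗ₜ[ℂ] v) = T (m + r) ⊗ₜ[ℂ] ⁅x, v⁆
  have h : S.coact n x = T m ⊗ₜ[ℂ] x := S.coactLin_homog n hx
  rw [S.loopAct_apply, degMap_zero, LinearMap.rTensor_zero, LinearMap.zero_apply, add_zero, h,
    LieAlgebra.ExtendScalars.bracket_tmul, T_mul]

/-- The action of a degree derivation on `v(r)`. -/
theorem CartanSplit.deg_vec (c : Deg n) (r : Fin n → ℤ) (v : V) :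
    ⁅(⟨0, c⟩ : S.tAlg n), S.vec n r v⁆ = c.wt r • S.vec n r v := by
  show S.loopAct n V ⟨0, c⟩ (T r ⊗ₜ[ℂ] v) = c.wt r • (T r ⊗ₜ[ℂ] v)
  rw [S.loopAct_apply, map_zero, t_zero_lie, zero_add, LinearMap.rTensor_tmul, degMap_T,
    TensorProduct.smul_tmul']

end LoopModule

/-! ### Induced modules and irreducible quotients -/

section Induced

variable (L : Type*) [LieRing L] [LieAlgebra ℂ L] (N : Set L) (B : LieSubalgebra ℂ L)
  (W : Type*) [AddCommGroup W] [Module ℂ W] [LieRingModule B W] [LieModule ℂ B W]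

/-- The `U(L)`-submodule of `U(L) ⊗ W` generated by `x ⊗ w` for `x ∈ N` and by
`y ⊗ w - 1 ⊗ y w` for `y ∈ B`. -/
def indRel : Submodule (UniversalEnvelopingAlgebra ℂ L) (UniversalEnvelopingAlgebra ℂ L ⊗[ℂ] W) :=
  Submodule.span _
    ({z | ∃ x ∈ N, ∃ w : W, z = UniversalEnvelopingAlgebra.ι ℂ x ⊗ₜ[ℂ] w} ∪
      {z | ∃ (y : B) (w : W),
        z = UniversalEnvelopingAlgebra.ι ℂ (y : L) ⊗ₜ[ℂ] w - 1 ⊗ₜ[ℂ] ⁅y, w⁆})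

/-- The induced module `U(L) ⊗_{U(N + B)} W`, where `N` acts by zero on the `B`-module `W`: the
quotient of `U(L) ⊗ W` by the relations `u x ⊗ w = 0` for `x ∈ N` and `u y ⊗ w = u ⊗ y w` for
`y ∈ B`. -/
def Induced : Type _ := (UniversalEnvelopingAlgebra ℂ L ⊗[ℂ] W) ⧸ indRel L N B W

instance : AddCommGroup (Induced L N B W) :=
  inferInstanceAs (AddCommGroup (_ ⧸ indRel L N B W))
instance : Module (UniversalEnvelopingAlgebra ℂ L) (Induced L N B W) :=
  inferInstanceAs (Module _ (_ ⧸ indRel L N B W))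
instance : Module ℂ (Induced L N B W) :=
  inferInstanceAs (Module ℂ (_ ⧸ indRel L N B W))
instance : IsScalarTower ℂ (UniversalEnvelopingAlgebra ℂ L) (Induced L N B W) :=
  inferInstanceAs (IsScalarTower ℂ _ (_ ⧸ indRel L N B W))

instance : LieRingModule L (Induced L N B W) where
  bracket x z := UniversalEnvelopingAlgebra.ι ℂ x • z
  add_lie x y z := by
    show UniversalEnvelopingAlgebra.ι ℂ (x + y) • z = _ • z + _ • z
    rw [map_add, add_smul]
  lie_add x y z := smul_add _ y z
  leibniz_lie x y z := by
    show UniversalEnvelopingAlgebra.ι ℂ x • UniversalEnvelopingAlgebra.ι ℂ y • z =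
      UniversalEnvelopingAlgebra.ι ℂ ⁅x, y⁆ • z +
      UniversalEnvelopingAlgebra.ι ℂ y • UniversalEnvelopingAlgebra.ι ℂ x • z
    have h : UniversalEnvelopingAlgebra.ι ℂ ⁅x, y⁆ =
        UniversalEnvelopingAlgebra.ι ℂ x * UniversalEnvelopingAlgebra.ι ℂ y -
        UniversalEnvelopingAlgebra.ι ℂ y * UniversalEnvelopingAlgebra.ι ℂ x :=
      letI : LieRing (UniversalEnvelopingAlgebra ℂ L) := LieRing.ofAssociativeRing
      (UniversalEnvelopingAlgebra.ι ℂ).map_lie x y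
    rw [h, sub_smul, mul_smul, mul_smul, sub_add_cancel]

instance : LieModule ℂ L (Induced L N B W) where
  smul_lie c x z := by
    show UniversalEnvelopingAlgebra.ι ℂ (c • x) • z = c • UniversalEnvelopingAlgebra.ι ℂ x • z
    rw [map_smul, smul_assoc]
  lie_smul c x z := smul_algebra_smul_comm c (UniversalEnvelopingAlgebra.ι ℂ x) z

variable (M : Type*) [AddCommGroup M] [Module ℂ M] [LieRingModule L M] [LieModule ℂ L M]

/-- The sum of all proper submodules of `M`. -/
def properSum : LieSubmodule ℂ L M := sSup {P : LieSubmodule ℂ L M | P ≠ ⊤}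

/-- The quotient of `M` by the sum of its proper submodules. For a highest weight module this is
the unique irreducible quotient. -/
abbrev IrrQuot : Type _ := M ⧸ properSum L M

end Induced

/-! ### Highest weight modules -/

section HighestWeight

variable {g : Type*} [LieRing g] [LieAlgebra ℂ g] (S : CartanSplit g) (n : ℕ)

/-- The one-dimensional `H`-module `ℂ(φ)`. -/
def CharModule {S : CartanSplit g} {n : ℕ} (_ : S.loopCartan n →ₗ[ℂ] ℂ) : Type := ℂ

theorem CartanSplit.loopCartan_lie (x y : S.loopCartan n) : ⁅x, y⁆ = 0 :=
  Subtype.ext (Subtype.ext (CartanSplit.lie_eq_zero x.2 y.2))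

section

variable {S n} (φ : S.loopCartan n →ₗ[ℂ] ℂ)

instance : AddCommGroup (CharModule φ) := inferInstanceAs (AddCommGroup ℂ)
instance : Module ℂ (CharModule φ) := inferInstanceAs (Module ℂ ℂ)

instance : LieRingModule (S.loopCartan n) (CharModule φ) where
  bracket x a := φ x • a
  add_lie x y a := by
    show φ (x + y) • a = φ x • a + φ y • a
    rw [map_add, add_smul]
  lie_add x a b := smul_add _ a b
  leibniz_lie x y a := by
    show φ x • φ y • a = φ ⁅x, y⁆ • a + φ y • φ x • a
    rw [S.loopCartan_lie, map_zero, zero_smul, zero_add, smul_comm]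

instance : LieModule ℂ (S.loopCartan n) (CharModule φ) where
  smul_lie c x a := by
    show φ (c • x) • a = c • φ x • a
    rw [map_smul, smul_assoc]
  lie_smul c x a := smul_comm (φ x) c a

/-- The non-graded module `M(φ)` over `𝔤'_A ⊕ 𝔥''`, for `φ ∈ H^*`. -/
abbrev VermaNG : Type _ :=
  Induced (S.loopAlg n) (S.loopPos n : Set (S.loopAlg n)) (S.loopCartan n) (CharModule φ)

/-- The non-graded irreducible highest weight module `V(φ)` over `𝔤'_A ⊕ 𝔥''`, for `φ ∈ H^*`. -/
abbrev VNG : Type _ := IrrQuot (S.loopAlg n) (VermaNG φ)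

end

/-- Highest weight vectors of a (non-graded) highest weight module over `𝔤'_A ⊕ 𝔥''`. They are
weight vectors for `𝔥`, since `𝔥 ⊗ 1 ⊆ H`. -/
structure IsHighestWeightVector {V : Type*} [AddCommGroup V] [Module ℂ V]
    [LieRingModule (S.loopAlg n) V] [LieModule ℂ (S.loopAlg n) V] (v : V) : Prop where
  ne_zero : v ≠ 0
  generates : LieSubmodule.lieSpan ℂ (S.loopAlg n) {v} = ⊤
  pos_lie : ∀ x ∈ S.loopPos n, ⁅x, v⁆ = 0
  cartan_lie : ∃ φ : S.loopCartan n →ₗ[ℂ] ℂ,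
    ∀ y : S.loopCartan n, ⁅(y : S.loopAlg n), v⁆ = φ y • v

/-- The component of degree `m` of `U(H)`: the span of the products of homogeneous elements of `H`
with total degree `m`. -/
def CartanSplit.uDeg (m : Fin n → ℤ) :
    Submodule ℂ (UniversalEnvelopingAlgebra ℂ (S.loopCartan n)) :=
  Submodule.span ℂ {u | ∃ w : List ((Fin n → ℤ) × S.loopCartan n),
    (∀ p ∈ w, ∃ a : g, ((p.2 : S.loopAlg n) : LPoly n ⊗[ℂ] g) = T p.1 ⊗ₜ[ℂ] a) ∧
    (w.map Prod.fst).sum = m ∧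
    u = (w.map fun p => UniversalEnvelopingAlgebra.ι ℂ p.2).prod}

/-- Graded algebra homomorphisms `ψ̄ : U(H) → A`. -/
structure GradedHom where
  toAlgHom : UniversalEnvelopingAlgebra ℂ (S.loopCartan n) →ₐ[ℂ] LPoly n
  map_deg : ∀ m, ∀ u ∈ S.uDeg n m, ∃ c : ℂ, toAlgHom u = c • T m

variable {S n}

namespace GradedHom

variable (ψ : GradedHom S n)

/-- The value of `ψ̄` on an element of `H`. -/
def val : S.loopCartan n →ₗ[ℂ] LPoly n where
  toFun y := ψ.toAlgHom (UniversalEnvelopingAlgebra.ι ℂ y)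
  map_add' x y := by rw [map_add, map_add]
  map_smul' c x := by rw [map_smul, map_smul, RingHom.id_apply]

/-- `ψ = E(1) ∘ ψ̄`, as an element of `H^*`. -/
def char : S.loopCartan n →ₗ[ℂ] ℂ := (evalOne n).toLinearMap ∘ₗ ψ.val

theorem val_homog {m : Fin n → ℤ} {y : S.loopCartan n} {a : g}
    (h : ((y : S.loopAlg n) : LPoly n ⊗[ℂ] g) = T m ⊗ₜ[ℂ] a) : ∃ c : ℂ, ψ.val y = c • T m :=
  ψ.map_deg m _ (Submodule.subset_span ⟨[(m, y)], by simpa using ⟨a, h⟩, by simp,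
    (List.prod_singleton (x := UniversalEnvelopingAlgebra.ι ℂ y)).symm⟩)

/-- The action of the degree derivations on `H`. -/
def degH (c : Deg n) (y : S.loopCartan n) : S.loopCartan n :=
  ⟨S.degDer n c y, affSub_degMap c y.2⟩

theorem val_deg (c : Deg n) (y : S.loopCartan n) : ψ.val (degH c y) = degMap c (ψ.val y) := by
  let f : S.loopCartan n →ₗ[ℂ] S.loopCartan n :=
    { toFun := degH c
      map_add' := fun x y => Subtype.ext (map_add (S.degDer n c) _ _)
      map_smul' := fun r x => Subtype.ext (map_smul (S.degDer n c) r _) }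
  have := CartanSplit.loopCartan_le (S := S) (n := n)
    (P := LinearMap.eqLocus (ψ.val ∘ₗ f) (degMap c ∘ₗ ψ.val)) (fun m y a hy => ?_) y
  · exact this
  · have hd : degH c y = c.wt m • y := by
      apply Subtype.ext
      apply Subtype.ext
      show (degMap c).rTensor g ((y : S.loopAlg n) : LPoly n ⊗[ℂ] g) =
        c.wt m • ((y : S.loopAlg n) : LPoly n ⊗[ℂ] g)
      rw [hy, LinearMap.rTensor_tmul, degMap_T, TensorProduct.smul_tmul']
    show ψ.val (degH c y) = degMap c (ψ.val y)
    obtain ⟨r, hr⟩ := ψ.val_homog hy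
    rw [hd, map_smul, hr, map_smul, degMap_T, smul_comm]

/-- `A` as an `𝔥̃_A`-module: `H` acts by multiplication through `ψ̄`, and `D` by degree
derivations. -/
def AModule (_ : GradedHom S n) : Type := LPoly n

instance : AddCommGroup ψ.AModule := inferInstanceAs (AddCommGroup (LPoly n))
instance : Module ℂ ψ.AModule := inferInstanceAs (Module ℂ (LPoly n))

/-- The action of `𝔥̃_A` on `A`. -/
def aAct (z : S.tCartan n) : LPoly n →ₗ[ℂ] LPoly n :=
  LinearMap.mulLeft ℂ (ψ.val ⟨(z : S.tAlg n).left, z.2⟩) + degMap (z : S.tAlg n).right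

theorem aAct_apply (z : S.tCartan n) (a : LPoly n) :
    ψ.aAct z a = ψ.val ⟨(z : S.tAlg n).left, z.2⟩ * a + degMap (z : S.tAlg n).right a := rfl

theorem aAct_add (x y : S.tCartan n) (a : LPoly n) :
    ψ.aAct (x + y) a = ψ.aAct x a + ψ.aAct y a := by
  have h1 : ψ.val ⟨((x + y : S.tCartan n) : S.tAlg n).left, (x + y).2⟩ =
      ψ.val ⟨(x : S.tAlg n).left, x.2⟩ + ψ.val ⟨(y : S.tAlg n).left, y.2⟩ :=
    map_add ψ.val ⟨(x : S.tAlg n).left, x.2⟩ ⟨(y : S.tAlg n).left, y.2⟩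
  have h2 : ((x + y : S.tCartan n) : S.tAlg n).right =
    (x : S.tAlg n).right + (y : S.tAlg n).right := rfl
  rw [aAct_apply, aAct_apply, aAct_apply, h1, h2, degMap_add, add_mul, LinearMap.add_apply]
  abel

theorem aAct_smul (c : ℂ) (x : S.tCartan n) (a : LPoly n) :
    ψ.aAct (c • x) a = c • ψ.aAct x a := by
  have h1 : ψ.val ⟨((c • x : S.tCartan n) : S.tAlg n).left, (c • x).2⟩ =
      c • ψ.val ⟨(x : S.tAlg n).left, x.2⟩ :=
    map_smul ψ.val c ⟨(x : S.tAlg n).left, x.2⟩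
  have h2 : ((c • x : S.tCartan n) : S.tAlg n).right = c • (x : S.tAlg n).right := rfl
  rw [aAct_apply, aAct_apply, h1, h2, degMap_smul, smul_mul_assoc, LinearMap.smul_apply, smul_add]

theorem aAct_lie (x y : S.tCartan n) (a : LPoly n) :
    ψ.aAct x (ψ.aAct y a) = ψ.aAct ⁅x, y⁆ a + ψ.aAct y (ψ.aAct x a) := by
  have h1 : ψ.val ⟨((⁅x, y⁆ : S.tCartan n) : S.tAlg n).left, (⁅x, y⁆ : S.tCartan n).2⟩ =
      degMap (x : S.tAlg n).right (ψ.val ⟨(y : S.tAlg n).left, y.2⟩) -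
      degMap (y : S.tAlg n).right (ψ.val ⟨(x : S.tAlg n).left, x.2⟩) := by
    rw [← val_deg, ← val_deg, ← map_sub]
    congr 1
    apply Subtype.ext
    have h0 : ⁅(x : S.tAlg n).left, (y : S.tAlg n).left⁆ = 0 :=
      Subtype.ext (CartanSplit.lie_eq_zero x.2 y.2)
    show ⁅(x : S.tAlg n).left, (y : S.tAlg n).left⁆ + S.degDer n (x : S.tAlg n).right _ -
      S.degDer n (y : S.tAlg n).right _ = _
    rw [h0, zero_add]
    rfl
  have h2 : ((⁅x, y⁆ : S.tCartan n) : S.tAlg n).right = 0 := rfl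
  simp only [aAct_apply]
  rw [h1, h2, degMap_zero, LinearMap.zero_apply, map_add, map_add, degMap_mul, degMap_mul,
    degMap_comm (x : S.tAlg n).right]
  ring

instance : LieRingModule (S.tCartan n) ψ.AModule where
  bracket z a := ψ.aAct z a
  add_lie x y a := ψ.aAct_add x y a
  lie_add x a b := map_add (ψ.aAct x) a b
  leibniz_lie x y a := ψ.aAct_lie x y a

instance : LieModule ℂ (S.tCartan n) ψ.AModule where
  smul_lie c x a := ψ.aAct_smul c x a
  lie_smul c x a := map_smul (ψ.aAct x) c a

theorem degMap_mem_range (c : Deg n) (u : UniversalEnvelopingAlgebra ℂ (S.loopCartan n)) :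
    degMap c (ψ.toAlgHom u) ∈ ψ.toAlgHom.range := by
  obtain ⟨t, rfl⟩ : ∃ t, UniversalEnvelopingAlgebra.mkAlgHom ℂ (S.loopCartan n) t = u :=
    RingCon.mkₐ_surjective _ u
  induction t using TensorAlgebra.induction with
  | algebraMap r =>
    rw [AlgHom.commutes, AlgHom.commutes, Algebra.algebraMap_eq_smul_one, map_smul,
      ← T_zero, degMap_T]
    refine ⟨0, ?_⟩
    simp [Deg.wt]
  | ι x => exact ⟨UniversalEnvelopingAlgebra.ι ℂ (degH c x), ψ.val_deg c x⟩
  | mul a b ha hb =>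
    rw [map_mul, map_mul, degMap_mul]
    exact add_mem (mul_mem ha ⟨_, rfl⟩) (mul_mem ⟨_, rfl⟩ hb)
  | add a b ha hb =>
    rw [map_add, map_add, map_add]
    exact add_mem ha hb

/-- `A_ψ̄`, the image of `ψ̄`, as an `𝔥̃_A`-submodule of `A`. -/
def image : LieSubmodule ℂ (S.tCartan n) ψ.AModule where
  carrier := (ψ.toAlgHom.range : Set (LPoly n))
  add_mem' ha hb := add_mem (S := Subalgebra ℂ (LPoly n)) ha hb
  zero_mem' := zero_mem ψ.toAlgHom.range
  smul_mem' c _ hx := Subalgebra.smul_mem ψ.toAlgHom.range hx c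
  lie_mem {z a} ha := by
    obtain ⟨u, rfl⟩ := ha
    exact add_mem (S := Subalgebra ℂ (LPoly n)) (mul_mem ⟨_, rfl⟩ ⟨u, rfl⟩)
      (ψ.degMap_mem_range _ u)

/-- The graded module `M(ψ̄)` over `𝔤̃_A`. -/
abbrev Verma : Type _ :=
  Induced (S.tAlg n) {z : S.tAlg n | z.left ∈ S.loopPos n ∧ z.right = 0} (S.tCartan n) ψ.image

/-- The graded irreducible highest weight module `V(ψ̄)` over `𝔤̃_A`. -/
abbrev VGr : Type _ := IrrQuot (S.tAlg n) ψ.Verma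

end GradedHom

variable (S n) in
/-- `U v(m)`: the `𝔤̃_A`-submodule of `V_A` generated by `v(m)`. -/
def CartanSplit.gen {V : Type*} [AddCommGroup V] [Module ℂ V]
    [LieRingModule (S.loopAlg n) V] [LieModule ℂ (S.loopAlg n) V] (v : V) (m : Fin n → ℤ) :
    LieSubmodule ℂ (S.tAlg n) (S.LoopModule n V) :=
  LieSubmodule.lieSpan ℂ (S.tAlg n) {S.vec n m v}

end HighestWeight

end KacMoodyLoop

end

open scoped TensorProduct
open KacMoodyLoop

/-! The simple roots are linearly independent, so some `x` in `𝔥` has `αᵢ(x) = 1` for all `i`, and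
`ad x` acts on `N⁻` with eigenvalues `-1, -2, …`. Write `a = ψ(x)`. If a module is generated by a
Cartan-stable space of vectors that are killed by `N⁺_A` and have `x`-eigenvalue `a`, each of its
elements is one of these top vectors plus eigenvectors for `a - 1, a - 2, …`
(`IsTriangular.lieSpan_le`), and an `x`-stable subspace contains the top component of each of its
elements (`top_mem`). An element `y` of `H` of degree `r` satisfies `ψ̄(y) = ψ(y) t^r`, so `𝔥̃_A`
acts on `A ⊗ v` exactly as on `A` through `ψ̄`. Hence the top space of `Uv(m)` is `t^m A_ψ̄ ⊗ v`
(`gen_le`, `topSpace_le_gen`).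

Irreducibility (`vec_mem_of_le_gen`): let `P` be a non-zero submodule of `Uv(m)`. Stability under
`D` puts some non-zero `w(k)` in `P`, so the image of `P` under the evaluation `v(r) ↦ v` is a
non-zero submodule of the irreducible module `V(ψ)`, and therefore contains `v`. The top component
of a preimage of `v` lies in `P` and still evaluates to `v`, so it is not zero. Irreducibility of
`A_ψ̄` then puts all of `t^m A_ψ̄ ⊗ v` in `P`, in particular `v(m)`.

Direct sum: every `v(k)` lies in the top space of some `Uv(m)` with `m ∈ G`, and the `v(k)` generate
`V_A`. If `Uv(k)` met the sum of the others, that sum would contain `v(k)`; comparing top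
components, `t^k` would lie in the sum of the `t^m A_ψ̄` with `m ≠ k`, whose elements have no term
in degree `k`.

Identification with `V(ψ̄)`: the map `M(ψ̄) → V_A` given by `a ↦ a ⊗ v` has image `Uv(0)`, and the
argument with top components shows that its kernel is the sum of all proper submodules.

Labels: the formula `ψ̄(y) = ψ(y) t^r` recovers `ψ̄` from `ψ`, and defines a graded homomorphism for
every `ψ`, since `H` is abelian. -/

namespace KacMoodyLoop

/-! ### Separation of eigenvectors and top components -/

section Eigen

/-- The usual Vandermonde-free elimination: an operator that separates `i` from `j` is used to kill
the term `p i`, one index at a time. A family of operators is allowed because no single degree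
derivation needs to be singled out to separate all degrees. -/
theorem mem_of_sum_mem_of_eigen {M ι F : Type*} [AddCommGroup M] [Module ℂ M] (P : Submodule ℂ M)
    (f : F → Module.End ℂ M) (hf : ∀ c, ∀ p ∈ P, f c p ∈ P) (μ : F → ι → ℂ) (j : ι)
    (hsep : ∀ i, i ≠ j → ∃ c, μ c i ≠ μ c j) (s : Finset ι) (hj : j ∉ s) (p : ι → M)
    (hp : ∀ c i, f c (p i) = μ c i • p i) (hs : p j + ∑ i ∈ s, p i ∈ P) : p j ∈ P := by
  classical
  induction s using Finset.induction_on generalizing p with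
  | empty => simpa using hs
  | insert i s his ih =>
    rw [Finset.mem_insert, not_or] at hj
    obtain ⟨c, hc⟩ := hsep i (Ne.symm hj.1)
    -- Applying `f c - μ c i` removes the term `p i` and rescales every other term, with a non-zero
    -- factor at `j`.
    have h1 := P.sub_mem (hf c _ hs) (P.smul_mem (μ c i) hs)
    have h2 : (μ c j - μ c i) • p j ∈ P := by
      refine ih hj.2 (fun k => (μ c k - μ c i) • p k) (fun d k => ?_) ?_
      · rw [map_smul, hp, smul_comm]
      · convert h1 using 1
        rw [Finset.sum_insert his]
        simp only [map_add, map_sum, hp, smul_add, Finset.smul_sum, sub_smul,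
          Finset.sum_sub_distrib]
        abel
    exact (P.smul_mem_iff (sub_ne_zero.2 (Ne.symm hc))).1 h2

variable {L : Type*} [LieRing L] [LieAlgebra ℂ L]
  {M : Type*} [AddCommGroup M] [Module ℂ M] [LieRingModule L M] [LieModule ℂ L M]
  {L' : Type*} [LieRing L'] [LieAlgebra ℂ L']
  {M' : Type*} [AddCommGroup M'] [Module ℂ M'] [LieRingModule L' M'] [LieModule ℂ L' M']

variable (M) in
/-- The sum of the eigenspaces of `x` for the eigenvalues `a - 1, a - 2, …`. -/
def lower (x : L) (a : ℂ) : Submodule ℂ M :=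
  ⨆ k : ℕ, (LieModule.toEnd ℂ L M x).eigenspace (a - (k + 1))

theorem mem_lower {x : L} {a : ℂ} (k : ℕ) {w : M} (hw : ⁅x, w⁆ = (a - (k + 1)) • w) :
    w ∈ lower M x a :=
  Submodule.mem_iSup_of_mem k (Module.End.mem_eigenspace_iff.2 hw)

theorem lower_le {x : L} {a : ℂ} {P : Submodule ℂ M}
    (h : ∀ (k : ℕ) (w : M), ⁅x, w⁆ = (a - (k + 1)) • w → w ∈ P) : lower M x a ≤ P :=
  iSup_le fun k w hw => h k w (Module.End.mem_eigenspace_iff.1 hw)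

/-- The eigenvalue `a` differs from every `a - (k + 1)`, so the component for `a` can be isolated by
polynomials in `x`, which preserve `P`. -/
theorem top_mem {x : L} {a : ℂ} {P : Submodule ℂ M} (hP : ∀ p ∈ P, ⁅x, p⁆ ∈ P) {w u : M}
    (hw : ⁅x, w⁆ = a • w) (hu : u ∈ lower M x a) (h : w + u ∈ P) : w ∈ P := by
  obtain ⟨s, hs⟩ := (Submodule.mem_iSup_iff_exists_finsupp _ _).1 hu
  obtain ⟨hs, rfl⟩ := hs
  -- One operator suffices; `none` indexes the top eigenvalue and `some k` the eigenvalue `a - (k +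
  -- 1)`.
  refine mem_of_sum_mem_of_eigen P (fun _ : Unit => LieModule.toEnd ℂ L M x) (fun _ => hP)
    (fun _ (i : Option ℕ) => i.elim a fun k => a - (k + 1)) none ?_
    (s.support.map Function.Embedding.some) (by simp) (fun i => i.elim w s) ?_ ?_
  · rintro (_ | k) hk
    · exact absurd rfl hk
    · refine ⟨(), fun h0 => ?_⟩
      have h1 : (k : ℂ) + 1 = 0 := by simpa using h0
      exact Nat.cast_add_one_ne_zero k h1
  · rintro _ (_ | k)
    · exact hw
    · exact Module.End.mem_eigenspace_iff.1 (hs k)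
  · simpa [Finsupp.sum] using h

theorem eq_zero_of_mem_lower {x : L} {a : ℂ} {w : M} (hw : ⁅x, w⁆ = a • w)
    (hl : w ∈ lower M x a) : w = 0 := by
  have := top_mem (P := (⊥ : Submodule ℂ M)) (x := x) (a := a) (w := w) (u := -w)
    (by simp) hw (neg_mem hl) (by simp)
  simpa using this

theorem top_unique {x : L} {a : ℂ} {w w' u u' : M} (hw : ⁅x, w⁆ = a • w) (hw' : ⁅x, w'⁆ = a • w')
    (hu : u ∈ lower M x a) (hu' : u' ∈ lower M x a) (h : w + u = w' + u') : w = w' := by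
  rw [← sub_eq_zero]
  refine eq_zero_of_mem_lower (x := x) (a := a) (by rw [lie_sub, hw, hw', smul_sub]) ?_
  rw [show w - w' = u' - u by rw [sub_eq_sub_iff_add_eq_add, h, add_comm]]
  exact sub_mem hu' hu

theorem map_mem_lower (f : M →ₗ[ℂ] M') {x : L} {x' : L'} (hf : ∀ m, f ⁅x, m⁆ = ⁅x', f m⁆) {a : ℂ}
    {u : M} (hu : u ∈ lower M x a) : f u ∈ lower M' x' a := by
  have : lower M x a ≤ (lower M' x' a).comap f :=
    lower_le fun k w hw => mem_lower k (by rw [← hf, hw, map_smul])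
  exact this hu

/-- A triangular decomposition `L = span Y + B + N` in which `x` acts on the elements of `Y` with
eigenvalues `-1, -2, …`. -/
structure IsTriangular (x : L) (Y B N : Set L) : Prop where
  wt : ∀ y ∈ Y, ∃ k : ℕ, ⁅x, y⁆ = -((k : ℂ) + 1) • y
  span : Submodule.span ℂ (Y ∪ B ∪ N) = ⊤

/-- A submodule generated by vectors of weight `a` that are killed by `N` consists of these vectors
and of sums of vectors of lower weights. -/
theorem IsTriangular.lieSpan_le {x : L} {Y B N : Set L} (h : IsTriangular x Y B N) {a : ℂ}
    (W : Submodule ℂ M) (hW : ∀ w ∈ W, ⁅x, w⁆ = a • w) (hB : ∀ b ∈ B, ∀ w ∈ W, ⁅b, w⁆ ∈ W)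
    (hN : ∀ z ∈ N, ∀ w ∈ W, ⁅z, w⁆ = 0) :
    (LieSubmodule.lieSpan ℂ L (W : Set M)).toSubmodule ≤ W ⊔ lower M x a := by
  -- `P` is the smallest `Y`-stable subspace containing `W`. It turns out to be stable under all of
  -- `L`, which avoids the Poincaré-Birkhoff-Witt theorem.
  let C : Set (Submodule ℂ M) := {Q | W ≤ Q ∧ ∀ y ∈ Y, ∀ q ∈ Q, ⁅y, q⁆ ∈ Q}
  let P : Submodule ℂ M := sInf C
  have hPW : W ≤ P := le_sInf fun Q hQ => hQ.1
  have hPY : ∀ y ∈ Y, ∀ q ∈ P, ⁅y, q⁆ ∈ P := fun y hy q hq =>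
    (Submodule.mem_sInf).2 fun Q hQ => hQ.2 y hy q (Submodule.mem_sInf.1 hq Q hQ)
  -- Allowing every `z : L` in the condition is what makes `Q` stable under `Y`: in `⁅z, ⁅y, q⁆⁆ =
  -- ⁅⁅z, y⁆, q⁆ + ⁅y, ⁅z, q⁆⁆` the element `⁅z, y⁆` is again arbitrary. Minimality of `P` then
  -- gives `P ≤ Q`.
  let Q : Submodule ℂ M :=
    { carrier := {p | p ∈ P ∧ ∀ z : L, ⁅z, p⁆ ∈ P}
      zero_mem' := ⟨P.zero_mem, fun z => by rw [lie_zero]; exact P.zero_mem⟩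
      add_mem' := fun hp hq => ⟨P.add_mem hp.1 hq.1, fun z => by
        rw [lie_add]; exact P.add_mem (hp.2 z) (hq.2 z)⟩
      smul_mem' := fun c p hp => ⟨P.smul_mem c hp.1, fun z => by
        rw [lie_smul]; exact P.smul_mem c (hp.2 z)⟩ }
  have hQ : Q ∈ C := by
    refine ⟨fun w hw => ⟨hPW hw, fun z => ?_⟩, fun y hy q hq => ⟨hPY y hy q hq.1, fun z => ?_⟩⟩
    · have hz : z ∈ Submodule.span ℂ (Y ∪ B ∪ N) := by rw [h.span]; trivial
      induction hz using Submodule.span_induction with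
      | mem z hz =>
        rcases hz with (hz | hz) | hz
        · exact hPY z hz w (hPW hw)
        · exact hPW (hB z hz w hw)
        · rw [hN z hz w hw]; exact P.zero_mem
      | zero => rw [zero_lie]; exact P.zero_mem
      | add z z' _ _ h1 h2 => rw [add_lie]; exact P.add_mem h1 h2
      | smul c z _ h1 => rw [smul_lie]; exact P.smul_mem c h1
    · rw [leibniz_lie]
      exact P.add_mem (hq.2 _) (hPY y hy _ (hq.2 z))
  have hPQ : P ≤ Q := sInf_le hQ
  have h1 : LieSubmodule.lieSpan ℂ L (W : Set M) ≤
      ({ P with lie_mem := fun {z m} hm => (hPQ hm).2 z } : LieSubmodule ℂ L M) :=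
    LieSubmodule.lieSpan_le.2 hPW
  have h2 : P ≤ W ⊔ lower M x a := by
    refine sInf_le ⟨le_sup_left, fun y hy q hq => ?_⟩
    obtain ⟨k, hk⟩ := h.wt y hy
    obtain ⟨w, hw, u, hu, rfl⟩ := Submodule.mem_sup.1 hq
    rw [lie_add]
    refine Submodule.mem_sup_right (add_mem (mem_lower k ?_) ?_)
    · rw [leibniz_lie, hk, hW w hw, smul_lie, lie_smul, ← add_smul]
      congr 1; ring
    · have : lower M x a ≤ (lower M x a).comap (LieModule.toEnd ℂ L M y) := by
        -- The weights add: `-(k + 1) + (a - (j + 1)) = a - ((k + j + 1) + 1)`.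
        refine lower_le fun j w hw => mem_lower (k + j + 1) ?_
        rw [LieModule.toEnd_apply_apply, leibniz_lie, hk, hw, smul_lie, lie_smul, ← add_smul]
        congr 1; push_cast; ring
      exact this hu
  exact fun m hm => h2 (h1 hm)

end Eigen

/-! ### The triangular decomposition of a Kac-Moody algebra -/

section Generators

variable {g : Type*} [LieRing g] [LieAlgebra ℂ g] {𝔞 : Submodule ℂ g} {E F : Set g}

theorem lie_mem_lieSpan (hF : ∀ a ∈ 𝔞, ∀ y ∈ F, ⁅a, y⁆ ∈ Submodule.span ℂ {y}) {a z : g}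
    (ha : a ∈ 𝔞) (hz : z ∈ LieSubalgebra.lieSpan ℂ g F) :
    ⁅a, z⁆ ∈ LieSubalgebra.lieSpan ℂ g F := by
  induction hz using LieSubalgebra.lieSpan_induction with
  | mem y hy =>
    obtain ⟨c, hc⟩ := Submodule.mem_span_singleton.1 (hF a ha y hy)
    rw [← hc]
    exact LieSubalgebra.smul_mem _ c (LieSubalgebra.subset_lieSpan hy)
  | zero => rw [lie_zero]; exact zero_mem _
  | add y z _ _ h1 h2 => rw [lie_add]; exact add_mem h1 h2
  | smul c z _ h => rw [lie_smul]; exact LieSubalgebra.smul_mem _ c h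
  | lie y z hy hz h1 h2 =>
    rw [leibniz_lie]
    exact add_mem (LieSubalgebra.lie_mem _ h1 hz) (LieSubalgebra.lie_mem _ hy h2)

/-- In `⁅e, ⁅y, z⁆⁆ = ⁅⁅e, y⁆, z⁆ + ⁅y, ⁅e, z⁆⁆` the inner brackets lie in the sum by induction, and
elements of that sum map the subalgebra generated by `F` to itself. It serves for `e_i` acting on
`N⁻` and, with the roles exchanged, for `f_i` acting on `N⁺`. -/
theorem lie_mem_lieSpan_sup (hF : ∀ a ∈ 𝔞, ∀ y ∈ F, ⁅a, y⁆ ∈ Submodule.span ℂ {y}) {e z : g}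
    (he : ∀ y ∈ F, ⁅e, y⁆ ∈ 𝔞) (hz : z ∈ LieSubalgebra.lieSpan ℂ g F) :
    ⁅e, z⁆ ∈ (LieSubalgebra.lieSpan ℂ g F).toSubmodule ⊔ 𝔞 := by
  have key : ∀ u ∈ (LieSubalgebra.lieSpan ℂ g F).toSubmodule ⊔ 𝔞,
      ∀ z ∈ LieSubalgebra.lieSpan ℂ g F, ⁅u, z⁆ ∈ LieSubalgebra.lieSpan ℂ g F := by
    intro u hu z hz
    obtain ⟨b, hb, a, ha, rfl⟩ := Submodule.mem_sup.1 hu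
    rw [add_lie]
    exact add_mem (LieSubalgebra.lie_mem _ hb hz) (lie_mem_lieSpan hF ha hz)
  induction hz using LieSubalgebra.lieSpan_induction with
  | mem y hy => exact Submodule.mem_sup_right (he y hy)
  | zero => rw [lie_zero]; exact zero_mem _
  | add y z _ _ h1 h2 => rw [lie_add]; exact add_mem h1 h2
  | smul c z _ h => rw [lie_smul]; exact Submodule.smul_mem _ c h
  | lie y z hy hz h1 h2 =>
    rw [leibniz_lie]
    refine Submodule.mem_sup_left (add_mem (key _ h1 z hz) ?_)
    rw [← lie_skew]
    exact neg_mem (key _ h2 y hy)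

/-- The sum is stable under the adjoint action of each generator, hence of every element; so it is a
subalgebra that contains the generators. Only the spanning half of the triangular decomposition is
needed, not directness. -/
theorem sup_lieSpan_eq_top (hE : ∀ a ∈ 𝔞, ∀ y ∈ E, ⁅a, y⁆ ∈ Submodule.span ℂ {y})
    (hF : ∀ a ∈ 𝔞, ∀ y ∈ F, ⁅a, y⁆ ∈ Submodule.span ℂ {y})
    (hEF : ∀ e ∈ E, ∀ f ∈ F, ⁅e, f⁆ ∈ 𝔞) (h𝔞 : ∀ a ∈ 𝔞, ∀ b ∈ 𝔞, ⁅a, b⁆ = 0)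
    (hgen : LieSubalgebra.lieSpan ℂ g (E ∪ F ∪ 𝔞) = ⊤) :
    (LieSubalgebra.lieSpan ℂ g F).toSubmodule ⊔ 𝔞 ⊔ (LieSubalgebra.lieSpan ℂ g E).toSubmodule
      = ⊤ := by
  set Q := (LieSubalgebra.lieSpan ℂ g F).toSubmodule ⊔ 𝔞 ⊔
    (LieSubalgebra.lieSpan ℂ g E).toSubmodule with hQ
  have hQF : (LieSubalgebra.lieSpan ℂ g F).toSubmodule ≤ Q := le_sup_left.trans le_sup_left
  have hQ𝔞 : 𝔞 ≤ Q := le_sup_right.trans le_sup_left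
  have hQE : (LieSubalgebra.lieSpan ℂ g E).toSubmodule ≤ Q := le_sup_right
  have split : ∀ {u : g}, (∀ z ∈ LieSubalgebra.lieSpan ℂ g F, ⁅u, z⁆ ∈ Q) →
      (∀ z ∈ 𝔞, ⁅u, z⁆ ∈ Q) → (∀ z ∈ LieSubalgebra.lieSpan ℂ g E, ⁅u, z⁆ ∈ Q) →
      ∀ q ∈ Q, ⁅u, q⁆ ∈ Q := by
    intro u h1 h2 h3 q hq
    obtain ⟨r, hr, z, hz, rfl⟩ := Submodule.mem_sup.1 hq
    obtain ⟨y, hy, a, ha, rfl⟩ := Submodule.mem_sup.1 hr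
    rw [lie_add, lie_add]
    exact add_mem (add_mem (h1 y hy) (h2 a ha)) (h3 z hz)
  have hE' : ∀ e ∈ E, ∀ q ∈ Q, ⁅e, q⁆ ∈ Q := fun e he =>
    split (fun z hz => (le_sup_left : _ ≤ Q) (lie_mem_lieSpan_sup hF (hEF e he) hz))
      (fun a ha => by
        rw [← lie_skew]
        exact hQE (neg_mem (lie_mem_lieSpan hE ha (LieSubalgebra.subset_lieSpan he))))
      (fun z hz => hQE (LieSubalgebra.lie_mem _ (LieSubalgebra.subset_lieSpan he) hz))
  have hF' : ∀ f ∈ F, ∀ q ∈ Q, ⁅f, q⁆ ∈ Q := fun f hf =>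
    split (fun z hz => hQF (LieSubalgebra.lie_mem _ (LieSubalgebra.subset_lieSpan hf) hz))
      (fun a ha => by
        rw [← lie_skew]
        exact hQF (neg_mem (lie_mem_lieSpan hF ha (LieSubalgebra.subset_lieSpan hf))))
      (fun z hz => (sup_le hQE hQ𝔞) (lie_mem_lieSpan_sup hE (fun e he => by
        rw [← lie_skew]
        exact neg_mem (hEF e he f hf)) hz))
  have h𝔞' : ∀ a ∈ 𝔞, ∀ q ∈ Q, ⁅a, q⁆ ∈ Q := fun a ha =>
    split (fun z hz => hQF (lie_mem_lieSpan hF ha hz))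
      (fun b hb => by rw [h𝔞 a ha b hb]; exact zero_mem _)
      (fun z hz => hQE (lie_mem_lieSpan hE ha hz))
  have hall : ∀ u : g, ∀ q ∈ Q, ⁅u, q⁆ ∈ Q := by
    intro u
    have hu : u ∈ LieSubalgebra.lieSpan ℂ g (E ∪ F ∪ 𝔞) := by rw [hgen]; trivial
    induction hu using LieSubalgebra.lieSpan_induction with
    | mem y hy =>
      rcases hy with (hy | hy) | hy
      exacts [hE' y hy, hF' y hy, h𝔞' y hy]
    | zero => intro q _; rw [zero_lie]; exact zero_mem _
    | add y z _ _ h1 h2 => intro q hq; rw [add_lie]; exact add_mem (h1 q hq) (h2 q hq)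
    | smul c z _ h => intro q hq; rw [smul_lie]; exact Submodule.smul_mem _ c (h q hq)
    | lie y z _ _ h1 h2 =>
      intro q hq
      rw [lie_lie]
      exact sub_mem (h1 _ (h2 q hq)) (h2 _ (h1 q hq))
  have hsub : LieSubalgebra.lieSpan ℂ g (E ∪ F ∪ 𝔞) ≤
      ({ Q with lie_mem' := fun {x y} _ hy => hall x y hy } : LieSubalgebra ℂ g) := by
    refine LieSubalgebra.lieSpan_le.2 ?_
    rintro y ((hy | hy) | hy)
    · exact hQE (LieSubalgebra.subset_lieSpan hy)
    · exact hQF (LieSubalgebra.subset_lieSpan hy)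
    · exact hQ𝔞 hy
  rw [eq_top_iff]
  intro u _
  exact hsub (by rw [hgen]; trivial)

/-- A subalgebra generated by eigenvectors of `ad x` with eigenvalue `-1` is spanned by eigenvectors
with negative integral eigenvalues. -/
theorem lieSpan_le_span_eigen {x : g} (hF : ∀ y ∈ F, ⁅x, y⁆ = -y) :
    (LieSubalgebra.lieSpan ℂ g F).toSubmodule ≤ Submodule.span ℂ
      {y | y ∈ LieSubalgebra.lieSpan ℂ g F ∧ ∃ k : ℕ, ⁅x, y⁆ = -((k : ℂ) + 1) • y} := by
  intro z hz
  have hz' : z ∈ LieSubalgebra.lieSpan ℂ g F := hz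
  clear hz
  induction hz' using LieSubalgebra.lieSpan_induction with
  | mem y hy =>
    refine Submodule.subset_span ⟨LieSubalgebra.subset_lieSpan hy, 0, ?_⟩
    rw [hF y hy]; simp
  | zero => exact zero_mem _
  | add y z _ _ h1 h2 => exact add_mem h1 h2
  | smul c z _ h => exact Submodule.smul_mem _ c h
  | lie y z hy hz h1 h2 =>
    clear hy hz
    induction h1, h2 using Submodule.span_induction₂ with
    | mem_mem a b ha hb =>
      obtain ⟨ha, j, hj⟩ := ha
      obtain ⟨hb, k, hk⟩ := hb
      -- The eigenvalues add: `-(j + 1) - (k + 1) = -((j + k + 1) + 1)`.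
      refine Submodule.subset_span ⟨LieSubalgebra.lie_mem _ ha hb, j + k + 1, ?_⟩
      rw [leibniz_lie, hj, hk, smul_lie, lie_smul, ← add_smul]
      congr 1; push_cast; ring
    | zero_left => rw [zero_lie]; exact zero_mem _
    | zero_right => rw [lie_zero]; exact zero_mem _
    | add_left _ _ _ _ _ _ h1 h2 => rw [add_lie]; exact add_mem h1 h2
    | add_right _ _ _ _ _ _ h1 h2 => rw [lie_add]; exact add_mem h1 h2
    | smul_left c _ _ _ _ h => rw [smul_lie]; exact Submodule.smul_mem _ c h
    | smul_right c _ _ _ _ h => rw [lie_smul]; exact Submodule.smul_mem _ c h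

end Generators

/-- The universal property gives a map to the subalgebra `K`; followed by the inclusion it fixes the
generators, so it is the identity. -/
theorem lieSpan_range_of {X : Type*} :
    LieSubalgebra.lieSpan ℂ (FreeLieAlgebra ℂ X) (Set.range (FreeLieAlgebra.of ℂ)) = ⊤ := by
  set K := LieSubalgebra.lieSpan ℂ (FreeLieAlgebra ℂ X) (Set.range (FreeLieAlgebra.of ℂ))
  let φ : FreeLieAlgebra ℂ X →ₗ⁅ℂ⁆ K := FreeLieAlgebra.lift ℂ fun x =>
    ⟨FreeLieAlgebra.of ℂ x, LieSubalgebra.subset_lieSpan ⟨x, rfl⟩⟩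
  have h : K.incl.comp φ = LieHom.id := by
    refine FreeLieAlgebra.hom_ext fun x => ?_
    rw [LieHom.comp_apply, FreeLieAlgebra.lift_of_apply]
    rfl
  rw [eq_top_iff]
  intro z _
  have hz : (φ z : FreeLieAlgebra ℂ X) = z := LieHom.congr_fun h z
  rw [← hz]
  exact (φ z).2

/-- A linear functional on the dual space with prescribed values on a linearly independent family
is the evaluation at a vector. -/
theorem exists_forall_apply_eq {V ι : Type*} [AddCommGroup V] [Module ℂ V]
    [FiniteDimensional ℂ V] {f : ι → Module.Dual ℂ V} (hf : LinearIndependent ℂ f) (c : ι → ℂ) :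
    ∃ x : V, ∀ i, f i x = c i := by
  obtain ⟨F, hF⟩ : ∃ F : Module.Dual ℂ V →ₗ[ℂ] ℂ, ∀ i, F (f i) = c i := by
    obtain ⟨F, hF⟩ := LinearMap.exists_extend ((Module.Basis.span hf).constr ℂ c)
    refine ⟨F, fun i => ?_⟩
    have h1 := LinearMap.congr_fun hF (Module.Basis.span hf i)
    rw [Module.Basis.constr_basis] at h1
    rw [← h1, LinearMap.comp_apply, Submodule.subtype_apply, Module.Basis.span_apply]
  -- Finite dimension makes every functional on the dual an evaluation.
  refine ⟨(Module.evalEquiv ℂ V).symm F, fun i => ?_⟩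
  rw [Module.apply_evalEquiv_symm_apply, hF]

namespace Realization

variable {l : ℕ} {C : Matrix (Fin l) (Fin l) ℤ} {𝔥 : Type*} [AddCommGroup 𝔥] [Module ℂ 𝔥]
  (R : Realization C 𝔥)

/-- The canonical map from the free Lie algebra to the Kac-Moody algebra. -/
noncomputable def proj : FreeLieAlgebra ℂ (Gen l 𝔥) →ₗ⁅ℂ⁆ R.KM where
  toFun z := LieSubmodule.Quotient.mk (N := R.radIdeal)
    (LieSubmodule.Quotient.mk (N := R.relIdeal) z : R.Aux)
  map_add' _ _ := rfl
  map_smul' _ _ := rfl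
  map_lie' := rfl

theorem proj_surjective : Function.Surjective R.proj := by
  intro z
  obtain ⟨y, rfl⟩ := Quot.mk_surjective z
  obtain ⟨x, rfl⟩ := Quot.mk_surjective y
  exact ⟨x, rfl⟩

theorem proj_rel {z : FreeLieAlgebra ℂ (Gen l 𝔥)} (hz : R.Rel z) : R.proj z = 0 := by
  show LieSubmodule.Quotient.mk (N := R.radIdeal)
    (LieSubmodule.Quotient.mk (N := R.relIdeal) z : R.Aux) = 0
  rw [R.auxGen_rel hz]
  rfl

theorem lie_gen_e_f (i : Fin l) : ⁅R.gen (.e i), R.gen (.f i)⁆ = R.hMap (R.coroot i) := by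
  have h := R.proj_rel (Rel.e_f i)
  rw [map_sub, LieHom.map_lie, sub_eq_zero] at h
  exact h

theorem lie_gen_e_f_ne {i j : Fin l} (hij : i ≠ j) : ⁅R.gen (.e i), R.gen (.f j)⁆ = 0 := by
  have h := R.proj_rel (Rel.e_f_ne i j hij)
  rw [LieHom.map_lie] at h
  exact h

theorem lie_hMap_e (x : 𝔥) (i : Fin l) : ⁅R.hMap x, R.gen (.e i)⁆ = R.root i x • R.gen (.e i) := by
  have h := R.proj_rel (Rel.h_e x i)
  rw [map_sub, LieHom.map_lie, map_smul, sub_eq_zero] at h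
  exact h

theorem lie_hMap_f (x : 𝔥) (i : Fin l) :
    ⁅R.hMap x, R.gen (.f i)⁆ = -(R.root i x • R.gen (.f i)) := by
  have h := R.proj_rel (Rel.h_f x i)
  rw [map_add, LieHom.map_lie, map_smul, add_eq_zero_iff_eq_neg] at h
  exact h

/-- The negative part: the subalgebra generated by the `f_i`. -/
noncomputable def neg : LieSubalgebra ℂ R.KM :=
  LieSubalgebra.lieSpan ℂ R.KM (Set.range fun i => R.gen (.f i))

theorem neg_sup_cartan_sup_pos :
    R.neg.toSubmodule ⊔ R.cartan ⊔ R.pos.toSubmodule = ⊤ := by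
  refine sup_lieSpan_eq_top ?_ ?_ ?_ R.cartan_abelian ?_
  · rintro _ ⟨x, rfl⟩ _ ⟨i, rfl⟩
    exact Submodule.mem_span_singleton.2 ⟨_, (R.lie_hMap_e x i).symm⟩
  · rintro _ ⟨x, rfl⟩ _ ⟨i, rfl⟩
    exact Submodule.mem_span_singleton.2 ⟨-R.root i x, by
      rw [neg_smul]; exact (R.lie_hMap_f x i).symm⟩
  · rintro _ ⟨i, rfl⟩ _ ⟨j, rfl⟩
    by_cases hij : i = j
    · subst hij
      exact ⟨_, (R.lie_gen_e_f i).symm⟩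
    · show ⁅R.gen (.e i), R.gen (.f j)⁆ ∈ R.cartan
      rw [R.lie_gen_e_f_ne hij]
      exact zero_mem _
  · set K := LieSubalgebra.lieSpan ℂ R.KM ((Set.range fun i => R.gen (.e i)) ∪
      (Set.range fun i => R.gen (.f i)) ∪ R.cartan)
    have h : LieSubalgebra.lieSpan ℂ (FreeLieAlgebra ℂ (Gen l 𝔥))
        (Set.range (FreeLieAlgebra.of ℂ)) ≤ K.comap R.proj := by
      refine LieSubalgebra.lieSpan_le.2 ?_
      rintro _ ⟨i | i | x, rfl⟩
      · exact LieSubalgebra.subset_lieSpan (Or.inl (Or.inl ⟨i, rfl⟩))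
      · exact LieSubalgebra.subset_lieSpan (Or.inl (Or.inr ⟨i, rfl⟩))
      · exact LieSubalgebra.subset_lieSpan (Or.inr ⟨x, rfl⟩)
    rw [eq_top_iff]
    intro z _
    obtain ⟨y, rfl⟩ := R.proj_surjective z
    exact h (by rw [lieSpan_range_of]; trivial)

/-- Each generator is itself a bracket, and brackets lie in `𝔤'`. This places `N⁺` and `N⁻` inside
`𝔤'`. -/
theorem lieSpan_le_derived {g : Type*} [LieRing g] [LieAlgebra ℂ g] {F : Set g}
    (hF : ∀ y ∈ F, ∃ x : g, ⁅x, y⁆ = y) :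
    (LieSubalgebra.lieSpan ℂ g F).toSubmodule ≤ derived g := by
  have h1 : ∀ x y : g, ⁅x, y⁆ ∈ derived g := fun x y =>
    LieSubmodule.lie_mem_lie (LieSubmodule.mem_top _) (LieSubmodule.mem_top _)
  have h : LieSubalgebra.lieSpan ℂ g F ≤
      ({ derived g with lie_mem' := fun {x y} _ _ => h1 x y } : LieSubalgebra ℂ g) := by
    refine LieSubalgebra.lieSpan_le.2 fun y hy => ?_
    obtain ⟨x, hx⟩ := hF y hy
    rw [← hx]
    exact h1 x y
  exact h

variable [FiniteDimensional ℂ 𝔥]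

/-- The analogue of `ρ^∨`: its adjoint action measures height. -/
theorem exists_root_eq_one : ∃ x : 𝔥, ∀ i, R.root i x = 1 :=
  exists_forall_apply_eq R.root_indep fun _ => 1

end Realization

/-- The properties of `𝔤 = N⁻ + 𝔥 + N⁺` that are used: `𝔤'` is spanned by `𝔥'`, by `N⁺` and by
eigenvectors of an element `x` of `𝔥` with eigenvalues `-1, -2, …`. -/
structure CartanSplit.HasDecomp {g : Type*} [LieRing g] [LieAlgebra ℂ g] (S : CartanSplit g)
    (x : g) : Prop where
  mem : x ∈ S.cartan
  pos_le : S.pos.toSubmodule ≤ derived g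
  le_sup : derived g ≤ Submodule.span ℂ
      {y | y ∈ derived g ∧ ∃ k : ℕ, ⁅x, y⁆ = -((k : ℂ) + 1) • y} ⊔ (S.cartan ⊓ derived g) ⊔
    S.pos.toSubmodule

theorem Realization.exists_hasDecomp {l : ℕ} {C : Matrix (Fin l) (Fin l) ℤ} {𝔥 : Type*}
    [AddCommGroup 𝔥] [Module ℂ 𝔥] [FiniteDimensional ℂ 𝔥] (R : Realization C 𝔥)
    (h₂ : Submodule ℂ R.KM) (hle : h₂ ≤ R.cartan) (hdisj : Disjoint (R.cartan ⊓ derived R.KM) h₂)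
    (hsup : (R.cartan ⊓ derived R.KM) ⊔ h₂ = R.cartan) :
    ∃ x, (R.split h₂ hle hdisj hsup).HasDecomp x := by
  obtain ⟨x, hx⟩ := R.exists_root_eq_one
  have hf : ∀ y ∈ Set.range fun i => R.gen (.f i), ⁅R.hMap x, y⁆ = -y := by
    rintro _ ⟨i, rfl⟩
    show ⁅R.hMap x, R.gen (.f i)⁆ = _
    rw [R.lie_hMap_f, hx, one_smul]
  have hpos : R.pos.toSubmodule ≤ derived R.KM := lieSpan_le_derived (by
    rintro _ ⟨i, rfl⟩
    exact ⟨R.hMap x, (R.lie_hMap_e x i).trans (by rw [hx, one_smul])⟩)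
  have hneg : R.neg.toSubmodule ≤ derived R.KM := lieSpan_le_derived fun y hy =>
    ⟨-R.hMap x, by rw [neg_lie, hf y hy, neg_neg]⟩
  refine ⟨R.hMap x, ⟨x, rfl⟩, hpos, fun z hz => ?_⟩
  have hz' : z ∈ R.neg.toSubmodule ⊔ R.cartan ⊔ R.pos.toSubmodule := by
    rw [R.neg_sup_cartan_sup_pos]; trivial
  obtain ⟨r, hr, e, he, rfl⟩ := Submodule.mem_sup.1 hz'
  obtain ⟨y, hy, a, ha, rfl⟩ := Submodule.mem_sup.1 hr
  -- The modular law: `N⁻` and `N⁺` lie in `𝔤'`, so the `𝔥`-component of an element of `𝔤'` lies in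
  -- `𝔥'`.
  have ha' : a ∈ derived R.KM := by
    have := sub_mem (sub_mem hz (hpos he)) (hneg hy)
    rwa [show y + a + e - e - y = a by abel] at this
  refine add_mem (Submodule.mem_sup_left (add_mem (Submodule.mem_sup_left ?_)
    (Submodule.mem_sup_right ⟨ha, ha'⟩))) (Submodule.mem_sup_right he)
  refine Submodule.span_mono ?_ (lieSpan_le_span_eigen hf hy)
  exact fun u hu => ⟨hneg hu.1, hu.2⟩

/-! ### Triangular decompositions of `𝔤'_A ⊕ 𝔥''` and `𝔤̃_A` -/

section Loop

variable {g : Type*} [LieRing g] [LieAlgebra ℂ g] {S : CartanSplit g} (n : ℕ)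

theorem CartanSplit.mem_affSub_of_mem_cartan {x : g} (hx : x ∈ S.cartan) :
    T (0 : Fin n → ℤ) ⊗ₜ[ℂ] x ∈ affSub n (S.cartan ⊓ derived g) S.compl := by
  rw [← S.sup_eq] at hx
  obtain ⟨y, hy, z, hz, rfl⟩ := Submodule.mem_sup.1 hx
  rw [TensorProduct.tmul_add]
  exact add_mem (mem_affSub 0 hy) (mem_affSub_zero hz)

theorem affSub_mono {W W' W₂ : Submodule ℂ g} (h : W ≤ W') : affSub n W W₂ ≤ affSub n W' W₂ :=
  affSub_le (fun m _ hx => mem_affSub m (h hx)) fun _ hx => mem_affSub_zero hx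

/-- The element `x ⊗ 1` of `𝔤'_A ⊕ 𝔥''` attached to `x ∈ 𝔥`. -/
noncomputable def CartanSplit.const {x : g} (hx : x ∈ S.cartan) : S.loopCartan n :=
  ⟨⟨T 0 ⊗ₜ[ℂ] x, affSub_mono n inf_le_right (S.mem_affSub_of_mem_cartan n hx)⟩,
    S.mem_affSub_of_mem_cartan n hx⟩

/-- The elements `y ⊗ t^m` with `y` an eigenvector of `x` with eigenvalue `-1, -2, …`. -/
def CartanSplit.loopNeg (S : CartanSplit g) (n : ℕ) (x : g) : Set (S.loopAlg n) :=
  {z | ∃ m, ∃ y ∈ derived g, (∃ k : ℕ, ⁅x, y⁆ = -((k : ℂ) + 1) • y) ∧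
    (z : LPoly n ⊗[ℂ] g) = T m ⊗ₜ[ℂ] y}

theorem CartanSplit.HasDecomp.loopAlg {x : g} (h : S.HasDecomp x) :
    IsTriangular (S.const n h.mem : S.loopAlg n) (S.loopNeg n x)
      (S.loopCartan n : Set (S.loopAlg n)) (S.loopPos n : Set (S.loopAlg n)) := by
  refine ⟨?_, ?_⟩
  · rintro z ⟨m, y, -, ⟨k, hk⟩, hz⟩
    refine ⟨k, Subtype.ext ?_⟩
    show ⁅T 0 ⊗ₜ[ℂ] x, (z : LPoly n ⊗[ℂ] g)⁆ = -((k : ℂ) + 1) • (z : LPoly n ⊗[ℂ] g)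
    rw [hz, LieAlgebra.ExtendScalars.bracket_tmul, hk, T_mul, zero_add, TensorProduct.tmul_smul]
  · set Q := Submodule.span ℂ (S.loopNeg n x ∪ (S.loopCartan n : Set (S.loopAlg n)) ∪
      (S.loopPos n : Set (S.loopAlg n))) with hQ
    have hle : affSub n (derived g) S.compl ≤ Q.map (S.loopAlg n).toSubmodule.subtype := by
      refine affSub_le (fun m a ha => ?_) (fun a ha => ?_)
      · have : Submodule.span ℂ {y | y ∈ derived g ∧ ∃ k : ℕ, ⁅x, y⁆ = -((k : ℂ) + 1) • y} ⊔
            (S.cartan ⊓ derived g) ⊔ S.pos.toSubmodule ≤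
            (Q.map (S.loopAlg n).toSubmodule.subtype).comap
              (TensorProduct.mk ℂ (LPoly n) g (T m)) := by
          refine sup_le (sup_le (Submodule.span_le.2 ?_) ?_) ?_
          · rintro y ⟨hy, hk⟩
            exact ⟨⟨T m ⊗ₜ[ℂ] y, mem_affSub m hy⟩,
              Submodule.subset_span (Or.inl (Or.inl ⟨m, y, hy, hk, rfl⟩)), rfl⟩
          · rintro y hy
            exact ⟨⟨T m ⊗ₜ[ℂ] y, mem_affSub m hy.2⟩,
              Submodule.subset_span (Or.inl (Or.inr (mem_affSub m hy))), rfl⟩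
          · rintro y hy
            exact ⟨⟨T m ⊗ₜ[ℂ] y, mem_affSub m (h.pos_le hy)⟩,
              Submodule.subset_span (Or.inr (Submodule.subset_span ⟨m, y, hy, rfl⟩)), rfl⟩
        exact this (h.le_sup ha)
      · exact ⟨⟨T 0 ⊗ₜ[ℂ] a, mem_affSub_zero ha⟩,
          Submodule.subset_span (Or.inl (Or.inr (mem_affSub_zero ha))), rfl⟩
    rw [eq_top_iff]
    intro z _
    obtain ⟨y, hy, hyz⟩ := hle z.2
    have : y = z := Subtype.ext hyz
    exact this ▸ hy

theorem CartanSplit.HasDecomp.tAlg {x : g} (h : S.HasDecomp x) :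
    IsTriangular (⟨(S.const n h.mem : S.loopAlg n), 0⟩ : S.tAlg n)
      (LieAlgebra.SemiDirectSum.inl (S.degDer n) '' S.loopNeg n x)
      (S.tCartan n : Set (S.tAlg n))
      {z : S.tAlg n | z.left ∈ S.loopPos n ∧ z.right = 0} := by
  refine ⟨?_, ?_⟩
  · rintro _ ⟨y, hy, rfl⟩
    obtain ⟨k, hk⟩ := (h.loopAlg n).wt y hy
    refine ⟨k, ?_⟩
    rw [← LieAlgebra.SemiDirectSum.inl_eq_mk, ← LieHom.map_lie, hk, map_smul]
  · set Q := Submodule.span ℂ (LieAlgebra.SemiDirectSum.inl (S.degDer n) '' S.loopNeg n x ∪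
      (S.tCartan n : Set (S.tAlg n)) ∪ {z : S.tAlg n | z.left ∈ S.loopPos n ∧ z.right = 0}) with hQ
    have h1 : Submodule.span ℂ (S.loopNeg n x ∪ (S.loopCartan n : Set (S.loopAlg n)) ∪
        (S.loopPos n : Set (S.loopAlg n))) ≤
        Q.comap (LieAlgebra.SemiDirectSum.inl (S.degDer n)).toLinearMap := by
      refine Submodule.span_le.2 ?_
      rintro y ((hy | hy) | hy)
      · exact Submodule.subset_span (Or.inl (Or.inl ⟨y, hy, rfl⟩))
      · exact Submodule.subset_span (Or.inl (Or.inr hy))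
      · exact Submodule.subset_span (Or.inr ⟨hy, rfl⟩)
    rw [(h.loopAlg n).span] at h1
    rw [eq_top_iff]
    intro z _
    have h2 : (⟨z.left, 0⟩ : S.tAlg n) ∈ Q := h1 (Submodule.mem_top (x := z.left))
    -- The degree derivations count as part of `𝔥̃_A`.
    have h3 : (⟨0, z.right⟩ : S.tAlg n) ∈ Q :=
      Submodule.subset_span (Or.inl (Or.inr (zero_mem (S.loopCartan n))))
    have := add_mem h2 h3
    rw [LieAlgebra.SemiDirectSum.add_eq_mk, add_zero, zero_add] at this
    exact this

end Loop

/-! ### Induced modules -/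

namespace Induced

variable {L : Type*} [LieRing L] [LieAlgebra ℂ L] {N : Set L} {B : LieSubalgebra ℂ L}
  {W : Type*} [AddCommGroup W] [Module ℂ W] [LieRingModule B W]

theorem ueaInduction {p : UniversalEnvelopingAlgebra ℂ L → Prop}
    (algebraMap : ∀ r : ℂ, p (algebraMap ℂ _ r))
    (ι : ∀ x : L, p (UniversalEnvelopingAlgebra.ι ℂ x))
    (mul : ∀ a b, p a → p b → p (a * b)) (add : ∀ a b, p a → p b → p (a + b))
    (u : UniversalEnvelopingAlgebra ℂ L) : p u := by
  obtain ⟨t, rfl⟩ : ∃ t, UniversalEnvelopingAlgebra.mkAlgHom ℂ L t = u :=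
    RingCon.mkₐ_surjective _ u
  induction t using TensorAlgebra.induction with
  | algebraMap r => rw [AlgHom.commutes]; exact algebraMap r
  | ι x => exact ι x
  | mul a b ha hb => rw [map_mul]; exact mul _ _ ha hb
  | add a b ha hb => rw [map_add]; exact add _ _ ha hb

variable (N B W) in
/-- The canonical map `w ↦ 1 ⊗ w` to the induced module. -/
noncomputable def of : W →ₗ[ℂ] Induced L N B W where
  toFun w := Submodule.Quotient.mk (p := indRel L N B W) (1 ⊗ₜ[ℂ] w)
  map_add' v w := by rw [TensorProduct.tmul_add]; rfl
  map_smul' c w := by rw [TensorProduct.tmul_smul]; rfl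

theorem lie_of_eq (x : L) (w : W) : ⁅x, of N B W w⁆ =
    Submodule.Quotient.mk (p := indRel L N B W) (UniversalEnvelopingAlgebra.ι ℂ x ⊗ₜ[ℂ] w) := by
  show Submodule.Quotient.mk (p := indRel L N B W)
    (UniversalEnvelopingAlgebra.ι ℂ x • (1 ⊗ₜ[ℂ] w)) = _
  rw [TensorProduct.smul_tmul', smul_eq_mul, mul_one]

theorem lie_of_eq_zero {x : L} (hx : x ∈ N) (w : W) : ⁅x, of N B W w⁆ = 0 := by
  rw [lie_of_eq]
  exact (Submodule.Quotient.mk_eq_zero _).2 (Submodule.subset_span (Or.inl ⟨x, hx, w, rfl⟩))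

theorem lie_of (y : B) (w : W) : ⁅(y : L), of N B W w⁆ = of N B W ⁅y, w⁆ := by
  rw [lie_of_eq]
  exact (Submodule.Quotient.eq _).2 (Submodule.subset_span (Or.inr ⟨y, w, rfl⟩))

theorem smul_mem_of_mem (P : LieSubmodule ℂ L (Induced L N B W))
    (u : UniversalEnvelopingAlgebra ℂ L) : ∀ z ∈ P, u • z ∈ P := by
  induction u using ueaInduction with
  | algebraMap r => intro z hz; rw [algebraMap_smul]; exact P.smul_mem r hz
  | ι x => intro z hz; exact P.lie_mem (x := x) hz
  | mul a b ha hb => intro z hz; rw [mul_smul]; exact ha _ (hb z hz)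
  | add a b ha hb => intro z hz; rw [add_smul]; exact add_mem (ha z hz) (hb z hz)

theorem lieSpan_range_of_eq_top :
    LieSubmodule.lieSpan ℂ L (LinearMap.range (of N B W) : Set (Induced L N B W)) = ⊤ := by
  set P := LieSubmodule.lieSpan ℂ L (LinearMap.range (of N B W) : Set (Induced L N B W))
  rw [eq_top_iff]
  intro z _
  obtain ⟨t, rfl⟩ := Submodule.Quotient.mk_surjective (indRel L N B W) z
  induction t using TensorProduct.induction_on with
  | zero => exact P.zero_mem
  | add a b ha hb => exact P.add_mem (ha trivial) (hb trivial)
  | tmul u w =>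
    have h : Submodule.Quotient.mk (p := indRel L N B W) (u ⊗ₜ[ℂ] w) = u • of N B W w := by
      show _ = Submodule.Quotient.mk (p := indRel L N B W) (u • (1 ⊗ₜ[ℂ] w))
      rw [TensorProduct.smul_tmul', smul_eq_mul, mul_one]
    rw [h]
    exact smul_mem_of_mem P u _ (LieSubmodule.subset_lieSpan ⟨w, rfl⟩)

variable {M : Type*} [AddCommGroup M] [Module ℂ M] [LieRingModule L M] [LieModule ℂ L M]

variable (L M) in
/-- The action of the enveloping algebra on a module. -/
noncomputable def ueaAct : UniversalEnvelopingAlgebra ℂ L →ₐ[ℂ] Module.End ℂ M :=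
  UniversalEnvelopingAlgebra.lift ℂ (LieModule.toEnd ℂ L M)

theorem ueaAct_ι (x : L) (m : M) :
    ueaAct L M (UniversalEnvelopingAlgebra.ι ℂ x) m = ⁅x, m⁆ := by
  rw [ueaAct, UniversalEnvelopingAlgebra.lift_ι_apply, LieModule.toEnd_apply_apply]

/-- The map `u ⊗ w ↦ u (f w)`. -/
noncomputable def liftAux (f : W →ₗ[ℂ] M) : UniversalEnvelopingAlgebra ℂ L ⊗[ℂ] W →ₗ[ℂ] M :=
  TensorProduct.lift (LinearMap.lcomp ℂ M f ∘ₗ (ueaAct L M).toLinearMap)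

theorem liftAux_tmul (f : W →ₗ[ℂ] M) (u : UniversalEnvelopingAlgebra ℂ L) (w : W) :
    liftAux f (u ⊗ₜ[ℂ] w) = ueaAct L M u (f w) := rfl

theorem liftAux_smul (f : W →ₗ[ℂ] M) (u : UniversalEnvelopingAlgebra ℂ L)
    (z : UniversalEnvelopingAlgebra ℂ L ⊗[ℂ] W) :
    liftAux f (u • z) = ueaAct L M u (liftAux f z) := by
  induction z using TensorProduct.induction_on with
  | zero => simp
  | add a b ha hb => rw [smul_add, map_add, ha, hb, map_add, map_add]
  | tmul a w =>
    rw [TensorProduct.smul_tmul', liftAux_tmul, liftAux_tmul, smul_eq_mul, map_mul,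
      Module.End.mul_apply]

/-- The universal property of the induced module. -/
theorem exists_lift (f : W →ₗ[ℂ] M) (hN : ∀ x ∈ N, ∀ w, ⁅x, f w⁆ = 0)
    (hB : ∀ (y : B) (w : W), f ⁅y, w⁆ = ⁅(y : L), f w⁆) :
    ∃ F : Induced L N B W →ₗ⁅ℂ, L⁆ M, ∀ w, F (of N B W w) = f w := by
  -- The map `u ⊗ w ↦ u (f w)` is linear over the enveloping algebra, so only the generating
  -- relations have to be checked.
  have hker : (indRel L N B W).restrictScalars ℂ ≤ LinearMap.ker (liftAux f) := by
    intro z hz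
    rw [Submodule.restrictScalars_mem] at hz
    show liftAux f z = 0
    induction hz using Submodule.span_induction with
    | mem z hz =>
      rcases hz with ⟨x, hx, w, rfl⟩ | ⟨y, w, rfl⟩
      · rw [liftAux_tmul, ueaAct_ι, hN x hx]
      · rw [map_sub, liftAux_tmul, liftAux_tmul, ueaAct_ι, map_one, Module.End.one_apply, hB,
          sub_self]
    | zero => exact map_zero _
    | add a b _ _ ha hb => rw [map_add, ha, hb, add_zero]
    | smul u a _ ha => rw [liftAux_smul, ha, map_zero]
  let F : Induced L N B W →ₗ[ℂ] M := ((indRel L N B W).restrictScalars ℂ).liftQ (liftAux f) hker ∘ₗ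
    (Submodule.Quotient.restrictScalarsEquiv ℂ (indRel L N B W)).symm.toLinearMap
  have hF : ∀ t, F (Submodule.Quotient.mk (p := indRel L N B W) t) = liftAux f t := fun _ => rfl
  refine ⟨{ F with map_lie' := fun {x z} => ?_ }, fun w => ?_⟩
  · obtain ⟨t, rfl⟩ := Submodule.Quotient.mk_surjective (indRel L N B W) z
    have h1 := liftAux_smul f (UniversalEnvelopingAlgebra.ι ℂ x) t
    rw [ueaAct_ι, ← hF, ← hF] at h1
    exact h1
  · show liftAux f (1 ⊗ₜ[ℂ] w) = f w
    rw [liftAux_tmul, map_one, Module.End.one_apply]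

end Induced

/-! ### Irreducible quotients -/

section IrrQuot

variable {L : Type*} [LieRing L] [LieAlgebra ℂ L]
  {M : Type*} [AddCommGroup M] [Module ℂ M] [LieRingModule L M] [LieModule ℂ L M]

/-- A proper submodule of the quotient pulls back to a proper submodule of `M`, which is contained
in the sum of all of these and so maps to zero. Nontriviality is assumed because that sum could a
priori be all of `M`; in the application a highest weight vector provides it. -/
theorem irrQuot_isIrreducible [Nontrivial (IrrQuot L M)] :
    LieModule.IsIrreducible ℂ L (IrrQuot L M) := by
  refine LieModule.IsIrreducible.mk fun P hP => ?_
  by_contra hne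
  refine hP ?_
  have h1 : P.comap (LieSubmodule.Quotient.mk' (properSum L M)) ≠ ⊤ := by
    intro h
    refine hne (eq_top_iff.2 fun z _ => ?_)
    obtain ⟨m, rfl⟩ := LieSubmodule.Quotient.surjective_mk' _ z
    have : m ∈ P.comap (LieSubmodule.Quotient.mk' (properSum L M)) := by rw [h]; trivial
    exact this
  have h2 : P.comap (LieSubmodule.Quotient.mk' (properSum L M)) ≤ properSum L M := le_sSup h1
  rw [eq_bot_iff]
  intro z hz
  obtain ⟨m, rfl⟩ := LieSubmodule.Quotient.surjective_mk' _ z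
  exact (LieSubmodule.Quotient.mk_eq_zero _).2 (h2 hz)

theorem irrQuot_lieSpan {s : Set M} (h : LieSubmodule.lieSpan ℂ L s = ⊤) :
    LieSubmodule.lieSpan ℂ L (LieSubmodule.Quotient.mk' (properSum L M) '' s) = ⊤ := by
  set P := LieSubmodule.lieSpan ℂ L (LieSubmodule.Quotient.mk' (properSum L M) '' s)
  have h1 : LieSubmodule.lieSpan ℂ L s ≤ P.comap (LieSubmodule.Quotient.mk' (properSum L M)) :=
    LieSubmodule.lieSpan_le.2 fun m hm => LieSubmodule.subset_lieSpan ⟨m, hm, rfl⟩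
  rw [h] at h1
  refine eq_top_iff.2 fun z _ => ?_
  obtain ⟨m, rfl⟩ := LieSubmodule.Quotient.surjective_mk' _ z
  exact h1 (LieSubmodule.mem_top m)

end IrrQuot

/-! ### The non-graded highest weight modules -/

section NonGraded

variable {g : Type*} [LieRing g] [LieAlgebra ℂ g] {S : CartanSplit g} {n : ℕ}

/-- The basis vector of `ℂ(φ)`. -/
def charOne (φ : S.loopCartan n →ₗ[ℂ] ℂ) : CharModule φ := (1 : ℂ)

theorem lie_charOne (φ : S.loopCartan n →ₗ[ℂ] ℂ) (y : S.loopCartan n) :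
    ⁅y, charOne φ⁆ = φ y • charOne φ := rfl

/-- The canonical generator of `V(φ)`. -/
noncomputable def hwVec (φ : S.loopCartan n →ₗ[ℂ] ℂ) : VNG φ :=
  LieSubmodule.Quotient.mk' (properSum (S.loopAlg n) (VermaNG φ))
    (Induced.of (S.loopPos n : Set (S.loopAlg n)) (S.loopCartan n) (CharModule φ) (charOne φ))

theorem pos_lie_hwVec (φ : S.loopCartan n →ₗ[ℂ] ℂ) {x : S.loopAlg n} (hx : x ∈ S.loopPos n) :
    ⁅x, hwVec φ⁆ = 0 := by
  rw [hwVec, ← LieModuleHom.map_lie, Induced.lie_of_eq_zero hx, map_zero]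

theorem cartan_lie_hwVec (φ : S.loopCartan n →ₗ[ℂ] ℂ) (y : S.loopCartan n) :
    ⁅(y : S.loopAlg n), hwVec φ⁆ = φ y • hwVec φ := by
  rw [hwVec, ← LieModuleHom.map_lie, Induced.lie_of, lie_charOne, map_smul, map_smul]

theorem lieSpan_hwVec (φ : S.loopCartan n →ₗ[ℂ] ℂ) :
    LieSubmodule.lieSpan ℂ (S.loopAlg n) {hwVec φ} = ⊤ := by
  rw [eq_top_iff, ← irrQuot_lieSpan Induced.lieSpan_range_of_eq_top, LieSubmodule.lieSpan_le]
  rintro _ ⟨_, ⟨w, rfl⟩, rfl⟩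
  have h : w = (show ℂ from w) • charOne φ := (mul_one (show ℂ from w)).symm
  rw [h, map_smul, map_smul]
  exact Submodule.smul_mem _ _ (LieSubmodule.subset_lieSpan rfl)

variable {V : Type*} [AddCommGroup V] [Module ℂ V] [LieRingModule (S.loopAlg n) V]
  [LieModule ℂ (S.loopAlg n) V]

/-- A module generated by a highest weight vector `v` is the sum of the line spanned by `v` and of
the lower weight spaces. -/
theorem span_sup_lower_eq_top {x : g} (hx : S.HasDecomp x) {v : V}
    {φ : S.loopCartan n →ₗ[ℂ] ℂ} (hgen : LieSubmodule.lieSpan ℂ (S.loopAlg n) {v} = ⊤)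
    (hpos : ∀ z ∈ S.loopPos n, ⁅z, v⁆ = 0)
    (hcar : ∀ y : S.loopCartan n, ⁅(y : S.loopAlg n), v⁆ = φ y • v) :
    Submodule.span ℂ {v} ⊔ lower V (S.const n hx.mem : S.loopAlg n) (φ (S.const n hx.mem)) = ⊤ := by
  rw [eq_top_iff]
  refine le_trans ?_ ((hx.loopAlg n).lieSpan_le (Submodule.span ℂ {v}) ?_ ?_ ?_)
  · intro w _
    have hw : w ∈ LieSubmodule.lieSpan ℂ (S.loopAlg n) {v} := by rw [hgen]; trivial
    exact LieSubmodule.lieSpan_mono Submodule.subset_span hw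
  · intro w hw
    obtain ⟨c, rfl⟩ := Submodule.mem_span_singleton.1 hw
    rw [lie_smul, hcar, smul_comm]
  · intro b hb w hw
    obtain ⟨c, rfl⟩ := Submodule.mem_span_singleton.1 hw
    have := hcar ⟨b, hb⟩
    rw [lie_smul]
    refine Submodule.smul_mem _ _ ?_
    rw [this]
    exact Submodule.smul_mem _ _ (Submodule.mem_span_singleton_self v)
  · intro z hz w hw
    obtain ⟨c, rfl⟩ := Submodule.mem_span_singleton.1 hw
    rw [lie_smul, hpos z hz, smul_zero]

/-- Eigenspaces are independent and `M` is spanned by eigenvectors for `a` and the `a - (k + 1)`, so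
no other eigenvalue occurs. It bounds the weight of one highest weight vector by that of another. -/
theorem exists_weight_sub {L M : Type*} [LieRing L] [LieAlgebra ℂ L] [AddCommGroup M] [Module ℂ M]
    [LieRingModule L M] [LieModule ℂ L M] {x : L} {a b : ℂ} {v w : M} (hv : ⁅x, v⁆ = a • v)
    (h : Submodule.span ℂ {v} ⊔ lower M x a = ⊤) (hw0 : w ≠ 0) (hw : ⁅x, w⁆ = b • w) :
    (b = a ∧ w ∈ Submodule.span ℂ {v}) ∨ ∃ k : ℕ, b = a - (k + 1) := by
  by_cases hk : ∃ k : ℕ, b = a - (k + 1)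
  · exact Or.inr hk
  obtain ⟨y, hy, u, hu, hyu⟩ := Submodule.mem_sup.1 (h ▸ Submodule.mem_top : w ∈ _)
  obtain ⟨c, rfl⟩ := Submodule.mem_span_singleton.1 hy
  have hcv : ⁅x, c • v⁆ = a • c • v := by rw [lie_smul, hv, smul_comm]
  by_cases hba : b = a
  · subst hba
    have := top_unique hw hcv (zero_mem (lower M x b)) hu (by rw [add_zero, hyu])
    exact Or.inl ⟨rfl, this ▸ hy⟩
  · refine absurd ?_ hw0
    refine Submodule.disjoint_def.1 ((LieModule.toEnd ℂ L M x).eigenspaces_iSupIndep b) w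
      (Module.End.mem_eigenspace_iff.2 hw) ?_
    rw [← hyu]
    refine add_mem (Submodule.mem_iSup_of_mem a (Submodule.mem_iSup_of_mem (Ne.symm hba)
      (Module.End.mem_eigenspace_iff.2 hcv))) ?_
    have hle : lower M x a ≤ ⨆ j, ⨆ (_ : j ≠ b), (LieModule.toEnd ℂ L M x).eigenspace j :=
      iSup_le fun k => le_iSup₂_of_le _ (fun hkb => hk ⟨k, hkb.symm⟩) le_rfl
    exact hle hu

/-- Highest weight vectors of a highest weight module are unique up to a scalar. -/
theorem IsHighestWeightVector.exists_smul {x : g} (hx : S.HasDecomp x)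
    {φ : S.loopCartan n →ₗ[ℂ] ℂ} {v : VNG φ} (hv : IsHighestWeightVector S n v) :
    ∃ c : ℂ, c ≠ 0 ∧ v = c • hwVec φ := by
  obtain ⟨hne, hgen, hpos, φ', hcar⟩ := hv
  have h1 := span_sup_lower_eq_top hx hgen hpos hcar
  have h2 := span_sup_lower_eq_top hx (lieSpan_hwVec φ) (fun _ => pos_lie_hwVec φ)
    (cartan_lie_hwVec φ)
  have h0 : hwVec φ ≠ 0 := by
    intro h0
    have h3 := lieSpan_hwVec φ
    rw [h0, (LieSubmodule.lieSpan_eq_bot_iff _ _ _).2 (by simp)] at h3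
    have : v ∈ (⊥ : LieSubmodule ℂ (S.loopAlg n) (VNG φ)) := by rw [h3]; trivial
    exact hne this
  -- Both vectors generate, so each weight equals the other or is lower by a positive integer. Two
  -- weights cannot each be strictly lower than the other, which leaves equality, where the top
  -- space is a line.
  have h3 := exists_weight_sub (hcar _) h1 h0 (cartan_lie_hwVec φ (S.const n hx.mem))
  have h4 := exists_weight_sub (cartan_lie_hwVec φ _) h2 hne (hcar (S.const n hx.mem))
  have h5 : v ∈ Submodule.span ℂ {hwVec φ} := by
    rcases h4 with h4 | ⟨j, hj⟩
    · exact h4.2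
    · exfalso
      rcases h3 with h3 | ⟨k, hk⟩
      · rw [h3.1] at hj
        have : (j : ℂ) + 1 = 0 := by linear_combination hj
        exact Nat.cast_add_one_ne_zero j this
      · rw [hk] at hj
        have : ((j + k + 1 : ℕ) : ℂ) + 1 = 0 := by push_cast; linear_combination hj
        exact Nat.cast_add_one_ne_zero _ this
  obtain ⟨c, rfl⟩ := Submodule.mem_span_singleton.1 h5
  exact ⟨c, fun hc => hne (by rw [hc, zero_smul]), rfl⟩

end NonGraded

/-! ### Homogeneous components and graded homomorphisms -/

section Graded

/-- The linear map `x ↦ ⁅x, w⁆`. -/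
def lieRight (L : Type*) {M : Type*} [LieRing L] [LieAlgebra ℂ L] [AddCommGroup M] [Module ℂ M]
    [LieRingModule L M] [LieModule ℂ L M] (w : M) : L →ₗ[ℂ] M where
  toFun x := ⁅x, w⁆
  map_add' x y := add_lie x y w
  map_smul' c x := smul_lie c x w

theorem lieSubmodule_ne_bot_iff {L M : Type*} [LieRing L] [AddCommGroup M] [Module ℂ M]
    [LieRingModule L M] {P : LieSubmodule ℂ L M} : P ≠ ⊥ ↔ ∃ m ∈ P, m ≠ 0 := by
  rw [Ne, LieSubmodule.eq_bot_iff]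
  push Not
  rfl

variable {g : Type*} [LieRing g] [LieAlgebra ℂ g] {S : CartanSplit g} {n : ℕ}

theorem evalOne_T (m : Fin n → ℤ) : evalOne n (T m) = 1 := by
  simp [evalOne, T]

theorem T_ne_zero (m : Fin n → ℤ) : (T m : LPoly n) ≠ 0 := by
  intro h
  have := evalOne_T m
  rw [h, map_zero] at this
  exact zero_ne_one this

/-- Distinct degrees are separated by the degree derivations. -/
theorem exists_wt_ne {i j : Fin n → ℤ} (h : i ≠ j) : ∃ c : Deg n, c.wt i ≠ c.wt j := by
  obtain ⟨k, hk⟩ := Function.ne_iff.1 h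
  -- The derivation `d_k`, for a coordinate `k` in which the two degrees differ.
  refine ⟨(Pi.single k 1 : Fin n → ℂ), ?_⟩
  have hw : ∀ m : Fin n → ℤ, Deg.wt (Pi.single k 1 : Fin n → ℂ) m = m k := by
    intro m
    simp [Deg.wt, Pi.single_apply]
  rw [hw, hw]
  exact_mod_cast hk

/-- A subspace of `A ⊗ V` that is stable under the degree derivations contains the homogeneous
components of its elements. -/
theorem component_mem {V : Type*} [AddCommGroup V] [Module ℂ V] (P : Submodule ℂ (LPoly n ⊗[ℂ] V))
    (hP : ∀ c : Deg n, ∀ p ∈ P, (degMap c).rTensor V p ∈ P) {p : LPoly n ⊗[ℂ] V} (hp : p ∈ P)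
    (hp0 : p ≠ 0) : ∃ k, ∃ w : V, w ≠ 0 ∧ T k ⊗ₜ[ℂ] w ∈ P := by
  classical
  obtain ⟨b, rfl⟩ := TensorProduct.eq_repr_basis_left (AddMonoidAlgebra.basis (Fin n → ℤ) ℂ) p
  have hb : b ≠ 0 := by
    rintro rfl
    exact hp0 Finsupp.sum_zero_index
  obtain ⟨k, hk⟩ := Finsupp.support_nonempty_iff.2 hb
  refine ⟨k, b k, Finsupp.mem_support_iff.1 hk, ?_⟩
  refine mem_of_sum_mem_of_eigen P (fun c : Deg n => (degMap c).rTensor V) hP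
    (fun c m => c.wt m) k (fun i hi => exists_wt_ne hi) (b.support.erase k)
    (Finset.notMem_erase _ _) (fun m => T m ⊗ₜ[ℂ] b m) (fun c m => ?_) ?_
  · rw [LinearMap.rTensor_tmul, degMap_T, TensorProduct.smul_tmul']
  · rw [Finset.add_sum_erase _ (fun m => T m ⊗ₜ[ℂ] b m) hk]
    simpa only [Finsupp.sum, basis_apply] using hp

/-- A subspace of `A` that is stable under the degree derivations contains the homogeneous
components of its elements. -/
theorem LPoly.component_mem (P : Submodule ℂ (LPoly n)) (hP : ∀ c : Deg n, ∀ p ∈ P, degMap c p ∈ P)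
    {p : LPoly n} (hp : p ∈ P) (k : Fin n → ℤ) :
    (AddMonoidAlgebra.basis (Fin n → ℤ) ℂ).repr p k • T k ∈ P := by
  classical
  set b := (AddMonoidAlgebra.basis (Fin n → ℤ) ℂ).repr p with hb
  by_cases hk : k ∈ b.support
  · refine mem_of_sum_mem_of_eigen P (degMap (n := n)) hP
      (fun c m => c.wt m) k (fun i hi => exists_wt_ne hi) (b.support.erase k)
      (Finset.notMem_erase _ _) (fun m => b m • T m) (fun c m => ?_) ?_
    · rw [map_smul, degMap_T, smul_comm]
    · rw [Finset.add_sum_erase _ (fun m => b m • T m) hk]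
      have h1 := (AddMonoidAlgebra.basis (Fin n → ℤ) ℂ).linearCombination_repr p
      rw [Finsupp.linearCombination_apply, ← hb] at h1
      simp only [Finsupp.sum, basis_apply] at h1
      rwa [h1]
  · rw [Finsupp.notMem_support_iff.1 hk, zero_smul]
    exact P.zero_mem

namespace GradedHom

variable (ψ : GradedHom S n)

/-- `A_ψ̄` is stable under `D`, so it contains each monomial `t^j` that occurs in `a`. A term of
`t^m a` in degree `k` would come from `j = k - m`, which is excluded. -/
theorem mul_mem_span {k : Fin n → ℤ} {a : LPoly n} (ha : a ∈ ψ.toAlgHom.range) {m : Fin n → ℤ}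
    (hm : T (k - m) ∉ ψ.toAlgHom.range) :
    T m * a ∈ Submodule.span ℂ (T '' {j : Fin n → ℤ | j ≠ k}) := by
  have hD : ∀ c : Deg n, ∀ p ∈ ψ.toAlgHom.range.toSubmodule,
      degMap c p ∈ ψ.toAlgHom.range.toSubmodule := by
    rintro c _ ⟨u, rfl⟩
    exact ψ.degMap_mem_range c u
  have hc := LPoly.component_mem ψ.toAlgHom.range.toSubmodule hD ha
  have h1 := (AddMonoidAlgebra.basis (Fin n → ℤ) ℂ).linearCombination_repr a
  rw [Finsupp.linearCombination_apply] at h1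
  rw [← h1, Finsupp.sum, Finset.mul_sum]
  refine Submodule.sum_mem _ fun j hj => ?_
  rw [basis_apply, mul_smul_comm, T_mul]
  refine Submodule.smul_mem _ _ (Submodule.subset_span ⟨m + j, ?_, rfl⟩)
  rintro rfl
  refine hm ?_
  rw [add_sub_cancel_left]
  exact (ψ.toAlgHom.range.toSubmodule.smul_mem_iff (Finsupp.mem_support_iff.1 hj)).1 (hc j)

theorem T_notMem_span (k : Fin n → ℤ) :
    (T k : LPoly n) ∉ Submodule.span ℂ (T '' {j : Fin n → ℤ | j ≠ k}) := by
  have h := (AddMonoidAlgebra.basis (Fin n → ℤ) ℂ).linearIndependent.notMem_span_image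
    (s := {j : Fin n → ℤ | j ≠ k}) (x := k) (by simp)
  rw [basis_apply] at h
  convert h using 4
  exact (basis_apply _).symm

/-- Gradedness gives `ψ̄(y) = c t^m`, and `E(1)` reads off `c`. This is how `ψ` determines `ψ̄`. -/
theorem val_homog_eq {m : Fin n → ℤ} {y : S.loopCartan n} {a : g}
    (h : ((y : S.loopAlg n) : LPoly n ⊗[ℂ] g) = T m ⊗ₜ[ℂ] a) : ψ.val y = ψ.char y • T m := by
  obtain ⟨c, hc⟩ := ψ.val_homog h
  have : ψ.char y = c := by
    show evalOne n (ψ.val y) = c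
    rw [hc, map_smul, evalOne_T, smul_eq_mul, mul_one]
  rw [this, hc]

end GradedHom

/-! ### The line `A ⊗ v` in `V_A`, and evaluation at `(1, …, 1)` -/

section LoopModule

section

variable {V : Type*} [AddCommGroup V] [Module ℂ V]

variable (S) in
/-- The map `a ↦ a ⊗ v` from `A` to `V_A`. -/
noncomputable def tens (v : V) : LPoly n →ₗ[ℂ] S.LoopModule n V :=
  (TensorProduct.mk ℂ (LPoly n) V).flip v

theorem tens_T (v : V) (m : Fin n → ℤ) : tens S v (T m) = S.vec n m v := rfl

/-- A functional on `V` that does not vanish at `v`, rescaled and applied to the second factor. It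
transfers questions about vectors `a ⊗ v` to `A`. -/
theorem exists_left_inverse_tens {v : V} (hv : v ≠ 0) :
    ∃ σ : S.LoopModule n V →ₗ[ℂ] LPoly n, ∀ a, σ (tens S v a) = a := by
  obtain ⟨τ, hτ⟩ := Module.Projective.exists_dual_ne_zero ℂ hv
  let σ : LPoly n ⊗[ℂ] V →ₗ[ℂ] LPoly n := (τ v)⁻¹ • (TensorProduct.rid ℂ (LPoly n)).toLinearMap ∘ₗ
    τ.lTensor (LPoly n)
  refine ⟨σ, fun a => ?_⟩
  show (τ v)⁻¹ • TensorProduct.rid ℂ (LPoly n) (τ.lTensor (LPoly n) (a ⊗ₜ[ℂ] v)) = a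
  rw [LinearMap.lTensor_tmul, TensorProduct.rid_tmul, smul_smul, inv_mul_cancel₀ hτ, one_smul]

variable (S n V) in
/-- The map `v(m) ↦ v` from `V_A` to `V`. -/
noncomputable def evalV : S.LoopModule n V →ₗ[ℂ] V :=
  (TensorProduct.lid ℂ V).toLinearMap ∘ₗ (evalOne n).toLinearMap.rTensor V

theorem evalV_tens (v : V) (b : LPoly n) : evalV S n V (tens S v b) = evalOne n b • v := by
  show TensorProduct.lid ℂ V ((evalOne n).toLinearMap.rTensor V (b ⊗ₜ[ℂ] v)) = _
  rw [LinearMap.rTensor_tmul, TensorProduct.lid_tmul]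
  rfl

theorem loopModule_induction {p : S.LoopModule n V → Prop} (zero : p 0)
    (tens : ∀ a v, p (tens S v a)) (add : ∀ a b, p a → p b → p (a + b)) (w : S.LoopModule n V) :
    p w :=
  TensorProduct.induction_on (R := ℂ) (M := LPoly n) (N := V) (motive := p) w zero tens add

end

variable {V : Type*} [AddCommGroup V] [Module ℂ V] [LieRingModule (S.loopAlg n) V]
  [LieModule ℂ (S.loopAlg n) V]

/-- A highest weight vector of weight `φ`. -/
structure IsHWVec (φ : S.loopCartan n →ₗ[ℂ] ℂ) (v : V) : Prop where
  ne_zero : v ≠ 0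
  generates : LieSubmodule.lieSpan ℂ (S.loopAlg n) {v} = ⊤
  pos_lie : ∀ x ∈ S.loopPos n, ⁅x, v⁆ = 0
  cartan_lie : ∀ y : S.loopCartan n, ⁅(y : S.loopAlg n), v⁆ = φ y • v

theorem lie_tens_of_homog {m : Fin n → ℤ} {y : S.loopAlg n} {a : g}
    (h : (y : LPoly n ⊗[ℂ] g) = T m ⊗ₜ[ℂ] a) (v : V) (b : LPoly n) :
    ⁅(⟨y, 0⟩ : S.tAlg n), tens S v b⁆ = tens S ⁅y, v⁆ (T m * b) := by
  show S.loopAct n V ⟨y, 0⟩ (b ⊗ₜ[ℂ] v) = (T m * b) ⊗ₜ[ℂ] ⁅y, v⁆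
  have h1 : S.coact n y = T m ⊗ₜ[ℂ] y := S.coactLin_homog n h
  rw [S.loopAct_apply, degMap_zero, LinearMap.rTensor_zero, LinearMap.zero_apply, add_zero, h1,
    LieAlgebra.ExtendScalars.bracket_tmul]

theorem deg_lie_tens (c : Deg n) (v : V) (b : LPoly n) :
    ⁅(⟨0, c⟩ : S.tAlg n), tens S v b⁆ = tens S v (degMap c b) := by
  show S.loopAct n V ⟨0, c⟩ (b ⊗ₜ[ℂ] v) = (degMap c b) ⊗ₜ[ℂ] v
  rw [S.loopAct_apply, map_zero, t_zero_lie, zero_add, LinearMap.rTensor_tmul]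

/-- Linear statements about the action of `𝔤'_A ⊕ 𝔥''` on a vector can be checked on homogeneous
elements. -/
theorem eqOn_of_homog {M : Type*} [AddCommGroup M] [Module ℂ M] {f f' : S.loopCartan n →ₗ[ℂ] M}
    (h : ∀ m (y : S.loopCartan n) (a : g),
      ((y : S.loopAlg n) : LPoly n ⊗[ℂ] g) = T m ⊗ₜ[ℂ] a → f y = f' y) : f = f' :=
  LinearMap.ext fun y => CartanSplit.loopCartan_le (P := LinearMap.eqLocus f f') h y

variable {ψ : GradedHom S n} {v : V}

/-- In degree `m`, `y` sends `b ⊗ v` to `ψ(y) t^m b ⊗ v`, and `ψ(y) t^m` is `ψ̄(y)`. Here the choice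
`ψ = E(1) ∘ ψ̄` is used. -/
theorem cartan_lie_tens (hv : IsHWVec ψ.char v) (y : S.loopCartan n) (b : LPoly n) :
    ⁅(⟨y, 0⟩ : S.tAlg n), tens S v b⁆ = tens S v (ψ.val y * b) := by
  let f : S.loopCartan n →ₗ[ℂ] S.LoopModule n V :=
    lieRight (S.tAlg n) (tens S v b) ∘ₗ
      (LieAlgebra.SemiDirectSum.inl (S.degDer n)).toLinearMap ∘ₗ
      (S.loopCartan n).toSubmodule.subtype
  let f' : S.loopCartan n →ₗ[ℂ] S.LoopModule n V :=
    tens S v ∘ₗ (LinearMap.mulRight ℂ b) ∘ₗ ψ.val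
  have : f = f' := eqOn_of_homog fun m y a hy => by
    show ⁅(⟨y, 0⟩ : S.tAlg n), tens S v b⁆ = tens S v (ψ.val y * b)
    rw [lie_tens_of_homog hy, hv.cartan_lie, ψ.val_homog_eq hy, smul_mul_assoc, map_smul]
    exact TensorProduct.tmul_smul _ _ _
  exact LinearMap.congr_fun this y

theorem tCartan_lie_tens (hv : IsHWVec ψ.char v) (z : S.tCartan n) (b : LPoly n) :
    ⁅(z : S.tAlg n), tens S v b⁆ = tens S v (ψ.aAct z b) := by
  have hz : (z : S.tAlg n) = ⟨(z : S.tAlg n).left, 0⟩ + ⟨0, (z : S.tAlg n).right⟩ := by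
    rw [LieAlgebra.SemiDirectSum.add_eq_mk, add_zero, zero_add]
  rw [hz, add_lie, deg_lie_tens, cartan_lie_tens hv ⟨(z : S.tAlg n).left, z.2⟩, ← map_add]
  rfl

theorem const_lie_tens (hv : IsHWVec ψ.char v) {x : g} (hx : x ∈ S.cartan) (b : LPoly n) :
    ⁅(⟨(S.const n hx : S.loopAlg n), 0⟩ : S.tAlg n), tens S v b⁆ =
      ψ.char (S.const n hx) • tens S v b := by
  rw [cartan_lie_tens hv, ψ.val_homog_eq (y := S.const n hx) (m := 0) (a := x) rfl, T_zero,
    smul_one_mul, map_smul]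

theorem loopPos_le (hpos : S.pos.toSubmodule ≤ derived g) {P : Submodule ℂ (S.loopAlg n)}
    (h : ∀ m (y : S.loopAlg n), ∀ a ∈ S.pos, (y : LPoly n ⊗[ℂ] g) = T m ⊗ₜ[ℂ] a → y ∈ P) :
    S.loopPos n ≤ P := by
  have hle : loopSub n S.pos.toSubmodule ≤ P.map (S.loopAlg n).toSubmodule.subtype := by
    refine Submodule.span_le.2 ?_
    rintro _ ⟨m, a, ha, rfl⟩
    exact ⟨⟨T m ⊗ₜ[ℂ] a, mem_affSub m (hpos ha)⟩, h m _ a ha rfl, rfl⟩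
  intro x hx
  obtain ⟨y, hy, hyx⟩ := hle hx
  have : y = x := Subtype.ext hyx
  exact this ▸ hy

theorem pos_lie_tens (hpos : S.pos.toSubmodule ≤ derived g) (hv : IsHWVec ψ.char v)
    {z : S.tAlg n} (hz : z.left ∈ S.loopPos n ∧ z.right = 0) (b : LPoly n) :
    ⁅z, tens S v b⁆ = 0 := by
  let f : S.loopAlg n →ₗ[ℂ] S.LoopModule n V :=
    lieRight (S.tAlg n) (tens S v b) ∘ₗ
      (LieAlgebra.SemiDirectSum.inl (S.degDer n)).toLinearMap
  have h : S.loopPos n ≤ LinearMap.ker f := loopPos_le hpos fun m y a ha hy => by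
    show ⁅(⟨y, 0⟩ : S.tAlg n), tens S v b⁆ = 0
    have hy' : y ∈ S.loopPos n := by
      show (y : LPoly n ⊗[ℂ] g) ∈ loopSub n S.pos.toSubmodule
      rw [hy]
      exact Submodule.subset_span ⟨m, a, ha, rfl⟩
    rw [lie_tens_of_homog hy, hv.pos_lie y hy']
    exact TensorProduct.tmul_zero _ _
  obtain ⟨x, c⟩ := z
  obtain ⟨hz1, rfl⟩ := hz
  exact h hz1

/-! ### Evaluation -/

/-- The shift of degree by `t^m` is invisible to evaluation, because `E(1) t^m = 1`. Only `𝔤'_A ⊕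
𝔥''` is involved: evaluation ignores the grading on which `D` acts. -/
theorem evalV_lie (y : S.loopAlg n) (w : S.LoopModule n V) :
    evalV S n V ⁅(⟨y, 0⟩ : S.tAlg n), w⁆ = ⁅y, evalV S n V w⁆ := by
  induction w using loopModule_induction with
  | zero => rw [lie_zero, map_zero, lie_zero]
  | add a b ha hb => rw [lie_add, map_add, ha, hb, map_add, lie_add]
  | tens b v =>
    let f : S.loopAlg n →ₗ[ℂ] V := evalV S n V ∘ₗ
      lieRight (S.tAlg n) (tens S v b) ∘ₗ
      (LieAlgebra.SemiDirectSum.inl (S.degDer n)).toLinearMap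
    let f' : S.loopAlg n →ₗ[ℂ] V :=
      lieRight (S.loopAlg n) (evalV S n V (tens S v b))
    refine CartanSplit.loopAlg_le (P := LinearMap.eqLocus f f') (fun m y a hy => ?_) y
    show evalV S n V ⁅(⟨y, 0⟩ : S.tAlg n), tens S v b⁆ = ⁅y, evalV S n V (tens S v b)⁆
    rw [lie_tens_of_homog hy, evalV_tens, evalV_tens, map_mul, evalOne_T, one_mul, lie_smul]

/-- The image of a submodule of `V_A` under evaluation. -/
noncomputable def evalSub (P : LieSubmodule ℂ (S.tAlg n) (S.LoopModule n V)) :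
    LieSubmodule ℂ (S.loopAlg n) V where
  __ := P.toSubmodule.map (evalV S n V)
  lie_mem := by
    rintro y _ ⟨w, hw, rfl⟩
    exact ⟨⁅(⟨y, 0⟩ : S.tAlg n), w⁆, P.lie_mem hw, evalV_lie y w⟩

/-- Evaluation is not injective in general, but it does not kill a non-zero homogeneous vector, and
`D`-stability provides one in `P`. -/
theorem evalSub_ne_bot {P : LieSubmodule ℂ (S.tAlg n) (S.LoopModule n V)} (hP : P ≠ ⊥) :
    evalSub P ≠ ⊥ := by
  obtain ⟨p, hp, hp0⟩ := lieSubmodule_ne_bot_iff.1 hP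
  obtain ⟨k, w, hw, hk⟩ := component_mem (n := n) (V := V) P.toSubmodule (fun c p hp => by
    have h : ⁅(⟨0, c⟩ : S.tAlg n), (show S.LoopModule n V from p)⁆ ∈ P := P.lie_mem hp
    have h1 : S.loopAct n V ⟨0, c⟩ p = (degMap c).rTensor V p := by
      rw [S.loopAct_apply, map_zero, t_zero_lie, zero_add]
    rw [← h1]
    exact h) hp hp0
  refine lieSubmodule_ne_bot_iff.2 ⟨w, ⟨tens S w (T k), hk, ?_⟩, hw⟩
  rw [evalV_tens, evalOne_T, one_smul]

end LoopModule

end Graded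

/-- A vector of top weight in a sum of such submodules equals its own top component, which is a sum
of top vectors. This reduces independence of the `Uv(m)` to a statement in `A`. -/
theorem mem_iSup_of_le_sup_lower {L M ι : Type*} [LieRing L] [LieAlgebra ℂ L] [AddCommGroup M]
    [Module ℂ M] [LieRingModule L M] [LieModule ℂ L M] {U W : ι → Submodule ℂ M} {x : L} {a : ℂ}
    (hU : ∀ i, U i ≤ W i ⊔ lower M x a) (hW : ∀ i, ∀ w ∈ W i, ⁅x, w⁆ = a • w) {w : M}
    (hw : ⁅x, w⁆ = a • w) (h : w ∈ ⨆ i, U i) : w ∈ ⨆ i, W i := by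
  have h1 : ⨆ i, U i ≤ (⨆ i, W i) ⊔ lower M x a :=
    iSup_le fun i => (hU i).trans (sup_le_sup_right (le_iSup W i) _)
  have h2 : ⨆ i, W i ≤ (LieModule.toEnd ℂ L M x).eigenspace a :=
    iSup_le fun i w hw => Module.End.mem_eigenspace_iff.2 (hW i w hw)
  obtain ⟨w', hw', u, hu, hwu⟩ := Submodule.mem_sup.1 (h1 h)
  have h3 : w' = w := top_unique (Module.End.mem_eigenspace_iff.1 (h2 hw')) hw hu (zero_mem _)
    (by rw [hwu, add_zero])
  exact h3 ▸ hw'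

theorem nonempty_equiv_quotient {L M M' : Type*} [LieRing L] [LieAlgebra ℂ L] [AddCommGroup M]
    [Module ℂ M] [LieRingModule L M] [LieModule ℂ L M] [AddCommGroup M'] [Module ℂ M']
    [LieRingModule L M'] [LieModule ℂ L M'] {F : M →ₗ⁅ℂ, L⁆ M'} {K : LieSubmodule ℂ L M}
    {Q : LieSubmodule ℂ L M'} (hK : K = F.ker) (hF : ∀ z, F z ∈ Q) (hQ : ∀ w ∈ Q, ∃ z, F z = w) :
    Nonempty (Q ≃ₗ⁅ℂ, L⁆ M ⧸ K) := by
  let F' : M →ₗ⁅ℂ, L⁆ Q := F.codRestrict Q hF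
  let E : M ⧸ K →ₗ[ℂ] Q := K.toSubmodule.liftQ F'.toLinearMap fun z hz => by
    rw [hK] at hz
    exact Subtype.ext (LieModuleHom.mem_ker.1 hz)
  have hE : ∀ z, E (LieSubmodule.Quotient.mk' K z) = F' z := fun _ => rfl
  have hbij : Function.Bijective E := by
    constructor
    · rw [injective_iff_map_eq_zero]
      intro q hq
      obtain ⟨z, rfl⟩ := LieSubmodule.Quotient.surjective_mk' _ q
      rw [hE] at hq
      rw [LieSubmodule.Quotient.mk_eq_zero, hK]
      exact LieModuleHom.mem_ker.2 (congrArg Subtype.val hq)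
    · rintro ⟨w, hw⟩
      obtain ⟨z, rfl⟩ := hQ w hw
      exact ⟨LieSubmodule.Quotient.mk' _ z, rfl⟩
  let e : (M ⧸ K) ≃ₗ⁅ℂ, L⁆ Q :=
    { LinearEquiv.ofBijective E hbij with
      map_lie' := fun {y q} => by
        obtain ⟨z, rfl⟩ := LieSubmodule.Quotient.surjective_mk' _ q
        exact F'.map_lie y z }
  exact ⟨e.symm⟩

/-! ### Top spaces, irreducibility and the direct sum decomposition -/

section Decomposition

variable {g : Type*} [LieRing g] [LieAlgebra ℂ g] {S : CartanSplit g} {n : ℕ}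
  {V : Type*} [AddCommGroup V] [Module ℂ V] [LieRingModule (S.loopAlg n) V]
  [LieModule ℂ (S.loopAlg n) V] {ψ : GradedHom S n} {v : V}

/-- The inclusion of `A_ψ̄` in `A`. -/
def GradedHom.incl (ψ : GradedHom S n) : ψ.image →ₗ[ℂ] LPoly n where
  toFun a := show LPoly n from a.1
  map_add' _ _ := rfl
  map_smul' _ _ := rfl

theorem GradedHom.incl_injective (ψ : GradedHom S n) : Function.Injective ψ.incl :=
  fun _ _ h => Subtype.ext h

theorem GradedHom.incl_mem (ψ : GradedHom S n) (a : ψ.image) : ψ.incl a ∈ ψ.toAlgHom.range := a.2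

/-- The vectors `a` of `A_ψ̄` with `t^m a ⊗ v ∈ P`. -/
noncomputable def pull (hv : IsHWVec ψ.char v) (m : Fin n → ℤ)
    (P : LieSubmodule ℂ (S.tAlg n) (S.LoopModule n V)) :
    LieSubmodule ℂ (S.tCartan n) ψ.image where
  __ := P.toSubmodule.comap (tens S v ∘ₗ LinearMap.mulLeft ℂ (T m) ∘ₗ ψ.incl)
  lie_mem := by
    intro z a ha
    have ha' : tens S v (T m * ψ.incl a) ∈ P := ha
    show tens S v (T m * ψ.aAct z (ψ.incl a)) ∈ P
    -- Multiplication by `t^m` commutes with `H` and shifts each degree derivation by a scalar, so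
    -- it carries `𝔥̃_A`-stable subspaces to `𝔥̃_A`-stable subspaces.
    have h1 : ψ.aAct z (T m * ψ.incl a) =
        T m * ψ.aAct z (ψ.incl a) + (z : S.tAlg n).right.wt m • (T m * ψ.incl a) := by
      rw [ψ.aAct_apply, ψ.aAct_apply, degMap_mul, degMap_T, smul_mul_assoc]
      ring
    have h2 := P.lie_mem (x := (z : S.tAlg n)) ha'
    rw [tCartan_lie_tens hv, h1, map_add, map_smul] at h2
    exact (P.toSubmodule.add_mem_iff_left (P.smul_mem _ ha')).1 h2

/-- The top weight space `t^m A_ψ̄ ⊗ v` of `U v(m)`. -/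
noncomputable def topSpace (ψ : GradedHom S n) (v : V) (m : Fin n → ℤ) :
    Submodule ℂ (S.LoopModule n V) :=
  ψ.toAlgHom.range.toSubmodule.map (tens S v ∘ₗ LinearMap.mulLeft ℂ (T m))

theorem tens_mem_topSpace {V : Type*} [AddCommGroup V] [Module ℂ V] {v : V} {m : Fin n → ℤ}
    {a : LPoly n} (ha : a ∈ ψ.toAlgHom.range) :
    tens S v (T m * a) ∈ topSpace ψ v m := ⟨a, ha, rfl⟩

theorem vec_mem_topSpace {V : Type*} [AddCommGroup V] [Module ℂ V] {v : V} (m : Fin n → ℤ) : S.vec n m v ∈ topSpace ψ v m := by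
  have := tens_mem_topSpace (S := S) (v := v) (m := m) (one_mem ψ.toAlgHom.range)
  rwa [mul_one] at this

/-- The part of `P` inside `t^m A_ψ̄ ⊗ v` corresponds to a submodule of `A_ψ̄`, which is
irreducible. -/
theorem topSpace_le_of_mem (hψ : LieModule.IsIrreducible ℂ (S.tCartan n) ψ.image)
    (hv : IsHWVec ψ.char v) {m : Fin n → ℤ} {P : LieSubmodule ℂ (S.tAlg n) (S.LoopModule n V)}
    {w : S.LoopModule n V} (hw0 : w ≠ 0) (hw : w ∈ topSpace ψ v m) (hwP : w ∈ P) :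
    topSpace ψ v m ≤ P.toSubmodule := by
  obtain ⟨a, ha, rfl⟩ := hw
  have ha0 : a ≠ 0 := by
    rintro rfl
    exact hw0 (map_zero _)
  have hne : pull hv m P ≠ ⊥ := lieSubmodule_ne_bot_iff.2
    ⟨⟨a, ha⟩, hwP, fun h => ha0 (congrArg Subtype.val h)⟩
  have htop := (hψ.eq_bot_or_eq_top (pull hv m P)).resolve_left hne
  rintro _ ⟨b, hb, rfl⟩
  have : (⟨b, hb⟩ : ψ.image) ∈ pull hv m P := by rw [htop]; trivial
  exact this

theorem vec_ne_zero {V : Type*} [AddCommGroup V] [Module ℂ V] {v : V} (hv : v ≠ 0)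
    (m : Fin n → ℤ) : S.vec n m v ≠ 0 := by
  obtain ⟨σ, hσ⟩ := exists_left_inverse_tens (S := S) (n := n) hv
  intro h
  have h1 := hσ (T m)
  rw [tens_T, h, map_zero] at h1
  exact T_ne_zero m h1.symm

theorem vec_mem_gen (v : V) (m : Fin n → ℤ) : S.vec n m v ∈ S.gen n v m :=
  LieSubmodule.subset_lieSpan rfl

theorem topSpace_le_gen (hψ : LieModule.IsIrreducible ℂ (S.tCartan n) ψ.image)
    (hv : IsHWVec ψ.char v) (m : Fin n → ℤ) : topSpace ψ v m ≤ (S.gen n v m).toSubmodule :=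
  topSpace_le_of_mem hψ hv (vec_ne_zero hv.ne_zero m) (vec_mem_topSpace m) (vec_mem_gen v m)

variable {x : g} (hx : S.HasDecomp x)

/-- The element of `𝔥̃_A` whose eigenvalues are used to separate the top weight spaces. -/
noncomputable def CartanSplit.HasDecomp.elt (n : ℕ) : S.tAlg n :=
  ⟨(S.const n hx.mem : S.loopAlg n), 0⟩

theorem elt_lie_topSpace (hv : IsHWVec ψ.char v) {m : Fin n → ℤ} {w : S.LoopModule n V}
    (hw : w ∈ topSpace ψ v m) : ⁅hx.elt n, w⁆ = ψ.char (S.const n hx.mem) • w := by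
  obtain ⟨a, _, rfl⟩ := hw
  exact const_lie_tens hv hx.mem (T m * a)

theorem gen_le (hv : IsHWVec ψ.char v)
    (m : Fin n → ℤ) : (S.gen n v m).toSubmodule ≤
      topSpace ψ v m ⊔ lower (S.LoopModule n V) (hx.elt n) (ψ.char (S.const n hx.mem)) := by
  refine le_trans ?_ ((hx.tAlg n).lieSpan_le (topSpace ψ v m)
    (fun w hw => elt_lie_topSpace hx hv hw) ?_ ?_)
  · exact LieSubmodule.lieSpan_mono (Set.singleton_subset_iff.2 (vec_mem_topSpace m))
  · rintro b hb _ ⟨a, ha, rfl⟩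
    have h2 : ⁅b, tens S v (T m * a)⁆ = tens S v (ψ.aAct ⟨b, hb⟩ (T m * a)) :=
      tCartan_lie_tens hv ⟨b, hb⟩ (T m * a)
    have h1 : ψ.aAct ⟨b, hb⟩ (T m * a) =
        T m * (ψ.aAct ⟨b, hb⟩ a + b.right.wt m • a) := by
      rw [ψ.aAct_apply, ψ.aAct_apply, degMap_mul, degMap_T, smul_mul_assoc, mul_add,
        mul_smul_comm]
      ring
    show ⁅b, tens S v (T m * a)⁆ ∈ topSpace ψ v m
    rw [h2, h1]
    exact tens_mem_topSpace (add_mem (ψ.image.lie_mem (x := ⟨b, hb⟩) ha)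
      (Subalgebra.smul_mem _ ha _))
  · rintro z hz _ ⟨a, _, rfl⟩
    exact pos_lie_tens hx.pos_le hv hz _

include hx in
/-- Every non-zero submodule of `U v(m)` contains `v(m)`. -/
theorem vec_mem_of_le_gen [LieModule.IsIrreducible ℂ (S.loopAlg n) V]
    (hψ : LieModule.IsIrreducible ℂ (S.tCartan n) ψ.image) (hv : IsHWVec ψ.char v)
    {m : Fin n → ℤ} {P : LieSubmodule ℂ (S.tAlg n) (S.LoopModule n V)} (hP : P ≠ ⊥)
    (hle : P ≤ S.gen n v m) : S.vec n m v ∈ P := by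
  have htop := (IsSimpleOrder.eq_bot_or_eq_top (evalSub P)).resolve_left (evalSub_ne_bot hP)
  obtain ⟨p, hp, hpv⟩ : v ∈ evalSub P := by rw [htop]; trivial
  obtain ⟨w, hw, u, hu, rfl⟩ := Submodule.mem_sup.1 (gen_le hx hv m (hle hp))
  have hxw := elt_lie_topSpace hx hv hw
  -- `P` is stable under `x`, so it contains the top component of `p`.
  have hwP : w ∈ P := top_mem (P := P.toSubmodule) (fun q hq => P.lie_mem hq) hxw hu hp
  have hev : ∀ q : S.LoopModule n V, evalV S n V ⁅hx.elt n, q⁆ =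
      ⁅(S.const n hx.mem : S.loopAlg n), evalV S n V q⁆ := fun q => evalV_lie _ q
  -- Evaluation commutes with `x`, so it sends top component to top component; the image `v` of `p`
  -- is its own top component.
  have h1 : evalV S n V w = v := by
    refine top_unique (x := (S.const n hx.mem : S.loopAlg n)) (a := ψ.char (S.const n hx.mem))
      ?_ (hv.cartan_lie _) (map_mem_lower (evalV S n V) hev hu) (zero_mem _) ?_
    · rw [← hev, hxw, map_smul]
    · rw [← map_add, hpv, add_zero]
  have hw0 : w ≠ 0 := by
    rintro rfl
    rw [map_zero] at h1
    exact hv.ne_zero h1.symm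
  exact topSpace_le_of_mem hψ hv hw0 hw hwP (vec_mem_topSpace m)

include hx in
theorem gen_isIrreducible [LieModule.IsIrreducible ℂ (S.loopAlg n) V]
    (hψ : LieModule.IsIrreducible ℂ (S.tCartan n) ψ.image) (hv : IsHWVec ψ.char v)
    (m : Fin n → ℤ) : LieModule.IsIrreducible ℂ (S.tAlg n) (S.gen n v m) := by
  have : Nontrivial (S.gen n v m) :=
    ⟨⟨⟨S.vec n m v, vec_mem_gen v m⟩, 0, fun h =>
      vec_ne_zero hv.ne_zero m (congrArg Subtype.val h)⟩⟩
  refine LieModule.IsIrreducible.mk fun P hP => ?_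
  have hne : P.map (S.gen n v m).incl ≠ ⊥ := by
    obtain ⟨p, hp, hp0⟩ := lieSubmodule_ne_bot_iff.1 hP
    exact lieSubmodule_ne_bot_iff.2 ⟨p, ⟨p, hp, rfl⟩, fun h => hp0 (Subtype.ext h)⟩
  have hle : P.map (S.gen n v m).incl ≤ S.gen n v m := by
    rintro _ ⟨p, _, rfl⟩
    exact p.2
  have h1 : S.gen n v m ≤ P.map (S.gen n v m).incl :=
    LieSubmodule.lieSpan_le.2 (Set.singleton_subset_iff.2 (vec_mem_of_le_gen hx hψ hv hne hle))
  rw [eq_top_iff]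
  intro q _
  obtain ⟨p, hp, hpq⟩ := h1 q.2
  have : p = q := Subtype.ext hpq
  exact this ▸ hp

theorem iSup_gen_eq_top (hψ : LieModule.IsIrreducible ℂ (S.tCartan n) ψ.image)
    (hv : IsHWVec ψ.char v) {G : Set (Fin n → ℤ)}
    (hG : ∀ k : Fin n → ℤ, ∃ m ∈ G, T (k - m) ∈ ψ.toAlgHom.range) :
    ⨆ m : G, (S.gen n v (m : Fin n → ℤ)).toSubmodule = ⊤ := by
  rw [← LieSubmodule.iSup_toSubmodule]
  set Q := ⨆ m : G, S.gen n v (m : Fin n → ℤ) with hQ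
  have h1 : ∀ k, S.vec n k v ∈ Q := by
    intro k
    -- With `m` the representative of `k`, `v(k) = t^m t^{k-m} ⊗ v` is a top vector of `Uv(m)`.
    obtain ⟨m, hm, hk⟩ := hG k
    have h2 := topSpace_le_gen hψ hv m (tens_mem_topSpace hk)
    rw [T_mul, add_sub_cancel, tens_T] at h2
    exact (le_iSup (fun m : G => S.gen n v (m : Fin n → ℤ)) ⟨m, hm⟩) h2
  -- The vectors of `V` all of whose shifts lie in the sum form a submodule containing the generator
  -- `v`, hence everything. Requiring all degrees at once makes it stable: `(X(m) w)(k) = X(m) w(k -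
  -- m)`.
  let K : LieSubmodule ℂ (S.loopAlg n) V :=
    { carrier := {w | ∀ k, S.vec n k w ∈ Q}
      zero_mem' := fun k => by
        have : S.vec n k (0 : V) = 0 := TensorProduct.tmul_zero _ _
        rw [this]
        exact Q.zero_mem
      add_mem' := fun {a b} ha hb k => by
        have : S.vec n k (a + b) = S.vec n k a + S.vec n k b := TensorProduct.tmul_add _ _ _
        rw [this]
        exact Q.add_mem (ha k) (hb k)
      smul_mem' := fun c a ha k => by
        have : S.vec n k (c • a) = c • S.vec n k a := TensorProduct.tmul_smul _ _ _
        rw [this]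
        exact Q.smul_mem c (ha k)
      lie_mem := fun {y w} hw k => by
        let f : V →ₗ[ℂ] S.LoopModule n V := TensorProduct.mk ℂ (LPoly n) V (T k)
        refine CartanSplit.loopAlg_le
          (P := Q.toSubmodule.comap (f ∘ₗ lieRight (S.loopAlg n) w)) (fun m y a hy => ?_) y
        show S.vec n k ⁅y, w⁆ ∈ Q
        have := S.lie_vec n V m (k - m) y a hy w
        rw [add_sub_cancel] at this
        rw [← this]
        exact Q.lie_mem (hw _) }
  have hK : ∀ w, w ∈ K := by
    intro w
    have h2 : LieSubmodule.lieSpan ℂ (S.loopAlg n) {v} ≤ K :=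
      LieSubmodule.lieSpan_le.2 (Set.singleton_subset_iff.2 h1)
    rw [hv.generates] at h2
    exact h2 (LieSubmodule.mem_top w)
  rw [eq_top_iff]
  intro w _
  induction w using loopModule_induction with
  | zero => exact Q.zero_mem
  | add a b ha hb => exact Q.add_mem (ha trivial) (hb trivial)
  | tens a w =>
    clear * - hK
    induction a using LPoly.induct with
    | hT k => exact hK w k
    | h0 => rw [map_zero]; exact Q.zero_mem
    | hadd a b ha hb => rw [map_add]; exact Q.add_mem ha hb
    | hsmul c a ha => rw [map_smul]; exact Q.smul_mem c ha

-- A non-zero intersection would contain `v(k)` by irreducibility. Then `v(k)` would be a sum of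
-- vectors in the `t^m A_ψ̄ ⊗ v` with `m ≠ k`, and these have no component in degree `k`.
include hx in
theorem iSupIndep_gen [LieModule.IsIrreducible ℂ (S.loopAlg n) V]
    (hψ : LieModule.IsIrreducible ℂ (S.tCartan n) ψ.image) (hv : IsHWVec ψ.char v)
    {G : Set (Fin n → ℤ)}
    (hG : ∀ k ∈ G, ∀ m ∈ G, T (k - m) ∈ ψ.toAlgHom.range → m = k) :
    iSupIndep fun m : G => (S.gen n v (m : Fin n → ℤ)).toSubmodule := by
  intro k
  set Q := ⨆ m : G, ⨆ _ : m ≠ k, S.gen n v (m : Fin n → ℤ) with hQ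
  have hQ' : (⨆ m : G, ⨆ _ : m ≠ k, (S.gen n v (m : Fin n → ℤ)).toSubmodule) = Q.toSubmodule := by
    simp only [hQ, LieSubmodule.iSup_toSubmodule]
  rw [hQ', disjoint_iff, ← LieSubmodule.inf_toSubmodule, LieSubmodule.toSubmodule_eq_bot]
  by_contra hne
  have h1 := (vec_mem_of_le_gen hx hψ hv hne inf_le_left).2
  have h2 : S.vec n k v ∈ ⨆ m : {m : G // m ≠ k}, topSpace ψ v (m : Fin n → ℤ) := by
    refine mem_iSup_of_le_sup_lower
      (U := fun m : {m : G // m ≠ k} => (S.gen n v (m : Fin n → ℤ)).toSubmodule)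
      (W := fun m : {m : G // m ≠ k} => topSpace ψ v (m : Fin n → ℤ)) (fun m => gen_le hx hv m)
      (fun m w hw => elt_lie_topSpace hx hv hw)
      (elt_lie_topSpace hx hv (vec_mem_topSpace (ψ := ψ) _)) ?_
    rw [iSup_subtype, hQ']
    exact h1
  obtain ⟨σ, hσ⟩ := exists_left_inverse_tens (S := S) (n := n) hv.ne_zero
  have h4 : ⨆ m : {m : G // m ≠ k}, topSpace ψ v (m : Fin n → ℤ) ≤
      (Submodule.span ℂ (T '' {j : Fin n → ℤ | j ≠ k})).comap σ := by
    refine iSup_le fun m => ?_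
    rintro _ ⟨b, hb, rfl⟩
    show σ (tens S v (T m * b)) ∈ Submodule.span ℂ (T '' {j : Fin n → ℤ | j ≠ k})
    rw [hσ]
    exact ψ.mul_mem_span hb fun h => m.2 (Subtype.ext (hG k k.2 m m.1.2 h))
  have h5 : σ (S.vec n k v) ∈ Submodule.span ℂ (T '' {j : Fin n → ℤ | j ≠ k}) := h4 h2
  rw [← tens_T, hσ] at h5
  exact GradedHom.T_notMem_span _ h5

include hx in
theorem isInternal_gen [LieModule.IsIrreducible ℂ (S.loopAlg n) V]
    (hψ : LieModule.IsIrreducible ℂ (S.tCartan n) ψ.image) (hv : IsHWVec ψ.char v)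
    {G : Set (Fin n → ℤ)}
    (hG : ∀ k : Fin n → ℤ, ∃! m : Fin n → ℤ, m ∈ G ∧ T (k - m) ∈ ψ.toAlgHom.range) :
    DirectSum.IsInternal fun m : G => (S.gen n v (m : Fin n → ℤ)).toSubmodule := by
  rw [DirectSum.isInternal_submodule_iff_iSupIndep_and_iSup_eq_top]
  refine ⟨iSupIndep_gen hx hψ hv fun k hk m hm hkm => ?_, iSup_gen_eq_top hψ hv fun k => ?_⟩
  -- `k` represents its own class, since `t^0 = 1` lies in `A_ψ̄`.
  · refine (hG k).unique ⟨hm, hkm⟩ ⟨hk, ?_⟩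
    rw [sub_self]
    exact one_mem ψ.toAlgHom.range
  · obtain ⟨m, ⟨hm, hkm⟩, _⟩ := hG k
    exact ⟨m, hm, hkm⟩

/-! ### The graded highest weight module -/

include hx in
theorem nonempty_equiv_VGr [LieModule.IsIrreducible ℂ (S.loopAlg n) V]
    (hψ : LieModule.IsIrreducible ℂ (S.tCartan n) ψ.image) (hv : IsHWVec ψ.char v) :
    Nonempty (S.gen n v 0 ≃ₗ⁅ℂ, S.tAlg n⁆ ψ.VGr) := by
  let N : Set (S.tAlg n) := {z | z.left ∈ S.loopPos n ∧ z.right = 0}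
  let ofV : ψ.image →ₗ[ℂ] ψ.Verma := Induced.of N (S.tCartan n) ψ.image
  obtain ⟨F, hF⟩ : ∃ F : ψ.Verma →ₗ⁅ℂ, S.tAlg n⁆ S.LoopModule n V,
      ∀ a : ψ.image, F (ofV a) = tens S v (ψ.incl a) :=
    Induced.exists_lift (tens S v ∘ₗ ψ.incl)
      (fun z hz a => pos_lie_tens hx.pos_le hv hz _) fun y a => (tCartan_lie_tens hv y _).symm
  let one : ψ.image := ⟨(1 : LPoly n), one_mem ψ.toAlgHom.range⟩
  have hF1 : F (ofV one) = S.vec n 0 v := hF one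
  have hgen : LieSubmodule.lieSpan ℂ (S.tAlg n) (LinearMap.range ofV : Set ψ.Verma) = ⊤ :=
    Induced.lieSpan_range_of_eq_top
  have hmem : ∀ z, F z ∈ S.gen n v 0 := by
    have h : LieSubmodule.lieSpan ℂ (S.tAlg n) (LinearMap.range ofV : Set ψ.Verma) ≤
        (S.gen n v 0).comap F := by
      refine LieSubmodule.lieSpan_le.2 ?_
      rintro _ ⟨a, rfl⟩
      show F (ofV a) ∈ S.gen n v 0
      have h1 := topSpace_le_gen hψ hv 0 (tens_mem_topSpace (ψ.incl_mem a))
      rw [T_zero, one_mul] at h1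
      rw [hF]
      exact h1
    rw [hgen] at h
    exact fun z => h (LieSubmodule.mem_top z)
  have hsurj : ∀ w ∈ S.gen n v 0, ∃ z, F z = w := by
    have h : S.gen n v 0 ≤ F.range :=
      LieSubmodule.lieSpan_le.2 (Set.singleton_subset_iff.2
        ((LieModuleHom.mem_range F _).2 ⟨_, hF1⟩))
    exact fun w hw => (LieModuleHom.mem_range F w).1 (h hw)
  have hofx : ∀ w ∈ LinearMap.range ofV, ⁅hx.elt n, w⁆ = ψ.char (S.const n hx.mem) • w := by
    rintro _ ⟨a, rfl⟩
    have h1 : ⁅hx.elt n, ofV a⁆ = ofV ⁅(⟨hx.elt n, (S.const n hx.mem).2⟩ : S.tCartan n), a⁆ :=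
      Induced.lie_of (⟨hx.elt n, (S.const n hx.mem).2⟩ : S.tCartan n) a
    have h2 : ⁅(⟨hx.elt n, (S.const n hx.mem).2⟩ : S.tCartan n), a⁆ =
        ψ.char (S.const n hx.mem) • a := by
      apply ψ.incl_injective
      show ψ.val (S.const n hx.mem) * ψ.incl a + degMap 0 (ψ.incl a) =
        ψ.char (S.const n hx.mem) • ψ.incl a
      rw [degMap_zero, LinearMap.zero_apply, add_zero,
        ψ.val_homog_eq (y := S.const n hx.mem) (m := 0) (a := x) rfl, T_zero, smul_one_mul]
    rw [h1, h2, map_smul]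
  have hdec : ∀ p : ψ.Verma, p ∈ LinearMap.range ofV ⊔
      lower ψ.Verma (hx.elt n) (ψ.char (S.const n hx.mem)) := by
    intro p
    refine (hx.tAlg n).lieSpan_le (LinearMap.range ofV) hofx ?_ ?_
      (hgen ▸ LieSubmodule.mem_top p : p ∈ LieSubmodule.lieSpan ℂ (S.tAlg n) _)
    · rintro b hb _ ⟨a, rfl⟩
      exact ⟨_, (Induced.lie_of (⟨b, hb⟩ : S.tCartan n) a).symm⟩
    · rintro z hz _ ⟨a, rfl⟩
      exact Induced.lie_of_eq_zero hz a
  obtain ⟨σ, hσ⟩ := exists_left_inverse_tens (S := S) (n := n) hv.ne_zero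
  -- The kernel is a proper submodule, hence contained in the sum. Conversely, a submodule not
  -- contained in the kernel has an image containing `v(0)`, and will be shown to be everything.
  have hker : properSum (S.tAlg n) ψ.Verma = F.ker := by
    refine le_antisymm (sSup_le fun P hP => ?_) (le_sSup fun h => ?_)
    · by_contra hle
      have hne : P.map F ≠ ⊥ := fun h => hle ((LieModuleHom.le_ker_iff_map P).2 h)
      have hPle : P.map F ≤ S.gen n v 0 := by
        rintro _ ⟨p, _, rfl⟩
        exact hmem p
      obtain ⟨p, hp, hpv⟩ := vec_mem_of_le_gen hx hψ hv hne hPle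
      obtain ⟨_, ⟨a, rfl⟩, u, hu, rfl⟩ := Submodule.mem_sup.1 (hdec p)
      have haP : ofV a ∈ P := top_mem (P := P.toSubmodule) (fun q hq => P.lie_mem hq)
        (hofx _ ⟨a, rfl⟩) hu hp
      -- Comparing top components in `F p = v(0)` forces the top component of `p` to be `1 ∈ A_ψ̄`.
      have h1 : tens S v (ψ.incl a) = S.vec n 0 v := by
        refine top_unique (x := hx.elt n) (a := ψ.char (S.const n hx.mem))
          (const_lie_tens hv hx.mem _) (const_lie_tens hv hx.mem (T 0))
          (map_mem_lower F.toLinearMap (fun m => F.map_lie _ m) hu) (zero_mem _) ?_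
        rw [add_zero, ← hpv, ← hF]
        exact (map_add F _ _).symm
      have h2 : ψ.incl a = 1 := by
        have := congrArg σ h1
        rwa [← tens_T, hσ, hσ, T_zero] at this
      -- The part of `A_ψ̄` inside `P` is a submodule containing `1`, so it is all of `A_ψ̄`, which
      -- generates `M(ψ̄)`.
      let K : LieSubmodule ℂ (S.tCartan n) ψ.image :=
        { P.toSubmodule.comap ofV with
          lie_mem := fun {y b} hb => by
            have h3 := P.lie_mem (x := (y : S.tAlg n)) (m := ofV b) hb
            rw [Induced.lie_of] at h3
            exact h3 }
      have hK : K ≠ ⊥ := lieSubmodule_ne_bot_iff.2 ⟨a, haP, fun h => by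
        have h3 : ψ.incl a = 0 := congrArg ψ.incl h
        rw [h2] at h3
        exact T_ne_zero 0 h3⟩
      have hKtop := (hψ.eq_bot_or_eq_top K).resolve_left hK
      refine hP (eq_top_iff.2 ?_)
      rw [← hgen]
      refine LieSubmodule.lieSpan_le.2 ?_
      rintro _ ⟨b, rfl⟩
      have : b ∈ K := by rw [hKtop]; trivial
      exact this
    · have h1 : ofV one ∈ F.ker := by rw [h]; trivial
      rw [LieModuleHom.mem_ker, hF1] at h1
      exact vec_ne_zero hv.ne_zero 0 h1
  exact nonempty_equiv_quotient hker hmem hsurj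

end Decomposition

/-! ### Graded homomorphisms and their labels -/

section Labels

variable {g : Type*} [LieRing g] [LieAlgebra ℂ g] {S : CartanSplit g} {n : ℕ}

theorem algHom_ext_ι {L A : Type*} [LieRing L] [LieAlgebra ℂ L] [Ring A] [Algebra ℂ A]
    {F F' : UniversalEnvelopingAlgebra ℂ L →ₐ[ℂ] A}
    (h : ∀ y, F (UniversalEnvelopingAlgebra.ι ℂ y) = F' (UniversalEnvelopingAlgebra.ι ℂ y)) :
    F = F' :=
  AlgHom.ext fun u => Induced.ueaInduction
    (p := fun u => F u = F' u) (fun r => by rw [AlgHom.commutes, AlgHom.commutes]) h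
    (fun a b ha hb => by rw [map_mul, map_mul, ha, hb])
    (fun a b ha hb => by rw [map_add, map_add, ha, hb]) u

/-- `ψ` fixes `ψ̄` on homogeneous elements of `H`; these span `H`, and `H` generates `U(H)`. -/
theorem GradedHom.char_injective : Function.Injective (GradedHom.char (S := S) (n := n)) := by
  intro ψ ψ' h
  have hval : ψ.val = ψ'.val := eqOn_of_homog fun m y a hy => by
    rw [ψ.val_homog_eq hy, ψ'.val_homog_eq hy, h]
  have halg : ψ.toAlgHom = ψ'.toAlgHom :=
    algHom_ext_ι fun y => LinearMap.congr_fun hval y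
  cases ψ
  cases ψ'
  cases halg
  rfl

/-- The graded linear map `H → A` with `y ↦ φ(y) t^m` for `y` homogeneous of degree `m`. -/
theorem exists_graded_val (φ : S.loopCartan n →ₗ[ℂ] ℂ) :
    ∃ f : S.loopCartan n →ₗ[ℂ] LPoly n, ∀ m (y : S.loopCartan n) (a : g),
      ((y : S.loopAlg n) : LPoly n ⊗[ℂ] g) = T m ⊗ₜ[ℂ] a → f y = φ y • T m := by
  obtain ⟨Φ, hΦ⟩ := LinearMap.exists_extend (p := (S.loopCartan n).toSubmodule) φ
  -- Apply `φ` to the second factor of the coaction `X(m) ↦ t^m ⊗ X(m)`. The coaction takes values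
  -- in `A ⊗ (𝔤'_A ⊕ 𝔥'')`, so `φ` is first extended from `H`; the choice of extension does not
  -- affect the values on homogeneous elements.
  refine ⟨(TensorProduct.rid ℂ (LPoly n)).toLinearMap ∘ₗ Φ.lTensor (LPoly n) ∘ₗ S.coactLin n ∘ₗ
    (S.loopCartan n).toSubmodule.subtype, fun m y a hy => ?_⟩
  show TensorProduct.rid ℂ (LPoly n) (Φ.lTensor (LPoly n) (S.coactLin n (y : S.loopAlg n))) = _
  rw [S.coactLin_homog n hy, LinearMap.lTensor_tmul, TensorProduct.rid_tmul]
  congr 1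
  exact LinearMap.congr_fun hΦ y

/-- `H` is abelian and `A` is commutative, so every linear map is a Lie homomorphism and extends to
`U(H)`. -/
theorem exists_algHom (f : S.loopCartan n →ₗ[ℂ] LPoly n) :
    ∃ F : UniversalEnvelopingAlgebra ℂ (S.loopCartan n) →ₐ[ℂ] LPoly n,
      ∀ y, F (UniversalEnvelopingAlgebra.ι ℂ y) = f y := by
  let _ : LieRing (LPoly n) := LieRing.ofAssociativeRing
  let f' : S.loopCartan n →ₗ⁅ℂ⁆ LPoly n :=
    { f with
      map_lie' := fun {x y} => by
        show f ⁅x, y⁆ = f x * f y - f y * f x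
        rw [S.loopCartan_lie, map_zero, mul_comm, sub_self] }
  exact ⟨UniversalEnvelopingAlgebra.lift ℂ f', fun y =>
    UniversalEnvelopingAlgebra.lift_ι_apply ℂ f' y⟩

theorem GradedHom.char_surjective : Function.Surjective (GradedHom.char (S := S) (n := n)) := by
  intro φ
  obtain ⟨f, hf⟩ := exists_graded_val φ
  obtain ⟨F, hF⟩ := exists_algHom f
  have hdeg : ∀ m, ∀ u ∈ S.uDeg n m, ∃ c : ℂ, F u = c • T m := by
    intro m u hu
    induction hu using Submodule.span_induction with
    | mem u hu =>
      obtain ⟨w, hw, rfl, rfl⟩ := hu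
      induction w with
      | nil => exact ⟨1, by simp [T_zero]⟩
      | cons p w ih =>
        obtain ⟨c, hc⟩ := ih fun q hq => hw q (List.mem_cons_of_mem _ hq)
        obtain ⟨a, ha⟩ := hw p List.mem_cons_self
        refine ⟨φ p.2 * c, ?_⟩
        rw [List.map_cons, List.prod_cons, List.map_cons, List.sum_cons, map_mul, hc, hF,
          hf _ _ _ ha, smul_mul_smul_comm, T_mul]
    | zero => exact ⟨0, by simp⟩
    | add a b _ _ ha hb =>
      obtain ⟨c, hc⟩ := ha
      obtain ⟨d, hd⟩ := hb
      exact ⟨c + d, by rw [map_add, hc, hd, add_smul]⟩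
    | smul r a _ ha =>
      obtain ⟨c, hc⟩ := ha
      exact ⟨r * c, by rw [map_smul, hc, smul_smul]⟩
  refine ⟨⟨F, hdeg⟩, eqOn_of_homog fun m y a hy => ?_⟩
  show evalOne n (F (UniversalEnvelopingAlgebra.ι ℂ y)) = φ y
  rw [hF, hf m y a hy, map_smul, evalOne_T, smul_eq_mul, mul_one]

/-- The definition allows any weight; uniqueness up to a scalar forces the weight to be the label
`φ` of the module. -/
theorem IsHighestWeightVector.isHWVec {x : g} (hx : S.HasDecomp x)
    {φ : S.loopCartan n →ₗ[ℂ] ℂ} {v : VNG φ} (hv : IsHighestWeightVector S n v) : IsHWVec φ v := by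
  obtain ⟨c, -, hvc⟩ := hv.exists_smul hx
  refine ⟨hv.ne_zero, hv.generates, hv.pos_lie, fun y => ?_⟩
  rw [hvc, lie_smul, cartan_lie_hwVec, smul_comm]

theorem VNG.isIrreducible {φ : S.loopCartan n →ₗ[ℂ] ℂ} {v : VNG φ} (hv : v ≠ 0) :
    LieModule.IsIrreducible ℂ (S.loopAlg n) (VNG φ) :=
  have : Nontrivial (VNG φ) := ⟨⟨v, 0, hv⟩⟩
  irrQuot_isIrreducible

end Labels

end KacMoodyLoop

theorem mainTheorem12 {l : ℕ} {C : Matrix (Fin l) (Fin l) ℤ} (hC : IsGCM C)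
    {𝔥 : Type*} [AddCommGroup 𝔥] [Module ℂ 𝔥] [FiniteDimensional ℂ 𝔥] (R : Realization C 𝔥)
    (h₂ : Submodule ℂ R.KM) (hle : h₂ ≤ R.cartan)
    (hdisj : Disjoint (R.cartan ⊓ derived R.KM) h₂)
    (hsup : (R.cartan ⊓ derived R.KM) ⊔ h₂ = R.cartan)
    {n : ℕ} (hn : 0 < n)
    (ψ : GradedHom (R.split h₂ hle hdisj hsup) n)
    (hψ : LieModule.IsIrreducible ℂ ((R.split h₂ hle hdisj hsup).tCartan n) ψ.image)
    (G : Set (Fin n → ℤ))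
    (hG : ∀ k : Fin n → ℤ, ∃! m : Fin n → ℤ, m ∈ G ∧ T (k - m) ∈ ψ.toAlgHom.range)
    (v : VNG ψ.char) (hv : IsHighestWeightVector (R.split h₂ hle hdisj hsup) n v) :
    DirectSum.IsInternal
        (fun m : G => ((R.split h₂ hle hdisj hsup).gen n v (m : Fin n → ℤ)).toSubmodule) ∧
      (∀ m ∈ G, LieModule.IsIrreducible ℂ ((R.split h₂ hle hdisj hsup).tAlg n)
        ((R.split h₂ hle hdisj hsup).gen n v m)) ∧
      Nonempty ((R.split h₂ hle hdisj hsup).gen n v 0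
        ≃ₗ⁅ℂ, (R.split h₂ hle hdisj hsup).tAlg n⁆ ψ.VGr) ∧
      Function.Bijective (GradedHom.char (S := R.split h₂ hle hdisj hsup) (n := n)) := by
  obtain ⟨x, hx⟩ := R.exists_hasDecomp h₂ hle hdisj hsup
  have hv' := hv.isHWVec hx
  have := VNG.isIrreducible hv.ne_zero
  refine ⟨isInternal_gen hx hψ hv' hG, fun m _ => gen_isIrreducible hx hψ hv' m,
    nonempty_equiv_VGr hx hψ hv', GradedHom.char_injective, GradedHom.char_surjective⟩
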